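/- Let $q=3^r$ with $r\ge 1$, let $\mathrm{tr}:\mathbb F_q\to\mathbb F_3$ be the trace, let $\lambda(x)=e^{2\pi i\,\mathrm{tr}(x)/3}$ be the canonical additive character of $\mathbb F_q$, and for $b\in\mathbb F_q^*$ let $K(\lambda;b)=\sum_{\alpha\in\mathbb F_q^*}\lambda(\alpha+b\alpha^{-1})$. For $n\ge 1$, let $Q=Q(2n+1,q)$ be the group of the $(2n+1)\times(2n+1)$ matrices over $\mathbb F_q$ (in blocks of sizes $n,n,1$) $$\begin{bmatrix}A&0&0\\0&{}^tA^{-1}&0\\0&0&1\end{bmatrix}\begin{bmatrix}1_n&B&-{}^th\\0&1_n&0\\0&h&1\end{bmatrix},\qquad A\in GL(n,q),\ B\in\mathbb F_q^{n\times n},\ h\in\mathbb F_q^{1\times n},\ B+{}^tB+{}^thh=0.$$ Let $\rho=\mathrm{diag}(1_n,1_n,-1)$ and, for $0\le s\le n$, let $\sigma_s$ be the permutation matrix exchanging the $j$-th and $(n+j)$-th basis vectors for $1\le j\le s$ and fixing all the others. Put $$DC_1^-(n,q)=Q\sigma_{n-1}Q,\quad DC_2^-(n,q)=\rho Q\sigma_{n-1}Q\quad(n\ge1\text{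 odd}),$$ $$DC_1^+(n,q)=Q\sigma_{n-2}Q,\quad DC_2^+(n,q)=\rho Q\sigma_{n-2}Q\quad(n\ge2\text{ even}).$$ With $\left[{n\atop s}\right]_q=\prod_{j=0}^{s-1}\frac{q^{n-j}-1}{q^{s-j}-1}$, put, for $n$ odd, $$A^-=q^{\frac14(5n^2-1)}\left[{n\atop 1}\right]_q\prod_{j=1}^{(n-1)/2}(q^{2j-1}-1),\qquad B^-=q^{\frac14(n-1)^2}(q^n-1)\prod_{j=1}^{(n-1)/2}(q^{2j}-1),$$ and, for $n\ge2$ even, $$A^+=q^{\frac14(5n^2-2n)}\left[{n\atop 2}\right]_q\prod_{j=1}^{(n-2)/2}(q^{2j-1}-1),\qquad B^+=q^{\frac14(n-2)^2}(q^n-1)(q^{n-1}-1)\prod_{j=1}^{(n-2)/2}(q^{2j}-1).$$ Let $i\in\{1,2\}$ and let $g_1,\dots,g_N$ be any ordering of the elements of $DC_i^{\mp}(n,q)$, where $N=|DC_i^{\mp}(n,q)|$. Let $v=(\mathrm{Tr}\,g_1,\dots,\mathrm{Tr}\,g_N)\in\mathbb F_q^N$ be the vector of matrix traces, let $C(DC_i^{\mp}(n,q))=\{u\in\mathbb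 F_3^N : u\cdot v=0\}$, and let $C(DC_i^{\mp}(n,q))^\perp\subseteq\mathbb F_3^N$ be the dual code. For $a\in\mathbb F_q^*$ put $$c_i^{\mp}(a)=(\mathrm{tr}(a\,\mathrm{Tr}\,g_1),\dots,\mathrm{tr}(a\,\mathrm{Tr}\,g_N)).$$ Then $c_i^{\mp}(a)\in C(DC_i^{\mp}(n,q))^\perp$, and its Hamming weight $w$ is given, for $i=1,2$, by: (1) for every odd $n\ge1$, $\quad w(c_i^-(a))=\tfrac23A^-\bigl(B^--(\mathrm{Re}\,\lambda(a))\,K(\lambda;a^2)\bigr)$; (2) for every even $n\ge2$, $\quad w(c_i^+(a))=\tfrac23A^+\bigl(B^+-(\mathrm{Re}\,\lambda(a))\,(K(\lambda;a^2)^2+q^2-q)\bigr)$. -/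

import Mathlib

noncomputable section

namespace TernaryKloosterman

/-- Positions of the rows and columns of a `(2n+1) × (2n+1)` matrix written in block form
with block sizes `n`, `n`, `1`. -/
abbrev BlockIdx (n : ℕ) : Type := (Fin n ⊕ Fin n) ⊕ Fin 1

/-- The subgroup `Q(2n+1,q)` of the orthogonal group
`O(2n+1,q) = {w | ᵗw J w = J}`, `J = [0 1ₙ 0; 1ₙ 0 0; 0 0 1]`, consisting of all products
`[A 0 0; 0 ᵗA⁻¹ 0; 0 0 1] * [1ₙ B -ᵗh; 0 1ₙ 0; 0 h 1]`
with `A ∈ GL(n,q)` and `B + ᵗB + ᵗh h = 0`. -/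
def subgroupQ (F : Type*) [Field F] (n : ℕ) : Set (Matrix (BlockIdx n) (BlockIdx n) F) :=
  {w | ∃ (A : GL (Fin n) F) (B : Matrix (Fin n) (Fin n) F) (h : Matrix (Fin 1) (Fin n) F),
    B + B.transpose + h.transpose * h = 0 ∧
    w = Matrix.fromBlocks
          (Matrix.fromBlocks (A : Matrix (Fin n) (Fin n) F) 0
            0 ((A⁻¹ : GL (Fin n) F) : Matrix (Fin n) (Fin n) F).transpose)
          0 0 1 *
        Matrix.fromBlocks
          (Matrix.fromBlocks 1 B 0 1)
          (Matrix.fromRows (-h.transpose) 0)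
          (Matrix.fromCols 0 h) 1}

/-- `ρ = diag(1ₙ, 1ₙ, -1)`. -/
def rho (F : Type*) [Field F] (n : ℕ) : Matrix (BlockIdx n) (BlockIdx n) F :=
  Matrix.fromBlocks 1 0 0 (-1)

/-- `σᵣ = [0 0 1ᵣ 0 0; 0 1ₙ₋ᵣ 0 0 0; 1ᵣ 0 0 0 0; 0 0 0 1ₙ₋ᵣ 0; 0 0 0 0 1]` for `r ≤ n`: it exchanges
the first `r` basis vectors of the first `n`-block with those of the second one. -/
def sigma (F : Type*) [Field F] (n r : ℕ) : Matrix (BlockIdx n) (BlockIdx n) F :=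
  Matrix.fromBlocks
    (Matrix.fromBlocks
      (Matrix.diagonal fun i : Fin n => if (i : ℕ) < r then 0 else 1)
      (Matrix.diagonal fun i : Fin n => if (i : ℕ) < r then 1 else 0)
      (Matrix.diagonal fun i : Fin n => if (i : ℕ) < r then 1 else 0)
      (Matrix.diagonal fun i : Fin n => if (i : ℕ) < r then 0 else 1))
    0 0 1

/-- The double coset `Q σᵣ Q`. -/
def cosetQ (F : Type*) [Field F] (n r : ℕ) : Set (Matrix (BlockIdx n) (BlockIdx n) F) :=
  DoubleCoset.doubleCoset (sigma F n r) (subgroupQ F n) (subgroupQ F n)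

/-- The set `ρ Q σᵣ Q`. -/
def cosetRhoQ (F : Type*) [Field F] (n r : ℕ) : Set (Matrix (BlockIdx n) (BlockIdx n) F) :=
  (fun w => rho F n * w) '' cosetQ F n r

/-- `DC₁⁻(n,q) = Q σₙ₋₁ Q`, used for odd `n`. -/
def DCMinus₁ (F : Type*) [Field F] (n : ℕ) : Set (Matrix (BlockIdx n) (BlockIdx n) F) :=
  cosetQ F n (n - 1)

/-- `DC₂⁻(n,q) = ρ Q σₙ₋₁ Q`, used for odd `n`. -/
def DCMinus₂ (F : Type*) [Field F] (n : ℕ) : Set (Matrix (BlockIdx n) (BlockIdx n) F) :=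
  cosetRhoQ F n (n - 1)

/-- `DC₁⁺(n,q) = Q σₙ₋₂ Q`, used for even `n ≥ 2`. -/
def DCPlus₁ (F : Type*) [Field F] (n : ℕ) : Set (Matrix (BlockIdx n) (BlockIdx n) F) :=
  cosetQ F n (n - 2)

/-- `DC₂⁺(n,q) = ρ Q σₙ₋₂ Q`, used for even `n ≥ 2`. -/
def DCPlus₂ (F : Type*) [Field F] (n : ℕ) : Set (Matrix (BlockIdx n) (BlockIdx n) F) :=
  cosetRhoQ F n (n - 2)

/-- The `q`-binomial coefficient `∏_{j=0}^{r-1} (q^{n-j} - 1) / (q^{r-j} - 1)`, for `r ≤ n`. -/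
def qBinom (n r q : ℕ) : ℝ :=
  ∏ j ∈ Finset.range r, ((q : ℝ) ^ (n - j) - 1) / ((q : ℝ) ^ (r - j) - 1)

/-- `A⁻(n,q)`, for odd `n`; all divisions of natural numbers are then exact. -/
def AMinus (n q : ℕ) : ℝ :=
  (q : ℝ) ^ ((5 * n ^ 2 - 1) / 4) * qBinom n 1 q *
    ∏ j ∈ Finset.Icc 1 ((n - 1) / 2), ((q : ℝ) ^ (2 * j - 1) - 1)

/-- `B⁻(n,q)`, for odd `n`; all divisions of natural numbers are then exact. -/
def BMinus (n q : ℕ) : ℝ :=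
  (q : ℝ) ^ ((n - 1) ^ 2 / 4) * ((q : ℝ) ^ n - 1) *
    ∏ j ∈ Finset.Icc 1 ((n - 1) / 2), ((q : ℝ) ^ (2 * j) - 1)

/-- `A⁺(n,q)`, for even `n ≥ 2`; all divisions of natural numbers are then exact. -/
def APlus (n q : ℕ) : ℝ :=
  (q : ℝ) ^ ((5 * n ^ 2 - 2 * n) / 4) * qBinom n 2 q *
    ∏ j ∈ Finset.Icc 1 ((n - 2) / 2), ((q : ℝ) ^ (2 * j - 1) - 1)

/-- `B⁺(n,q)`, for even `n ≥ 2`; all divisions of natural numbers are then exact. -/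
def BPlus (n q : ℕ) : ℝ :=
  (q : ℝ) ^ ((n - 2) ^ 2 / 4) * ((q : ℝ) ^ n - 1) * ((q : ℝ) ^ (n - 1) - 1) *
    ∏ j ∈ Finset.Icc 1 ((n - 2) / 2), ((q : ℝ) ^ (2 * j) - 1)

/-- The canonical additive character `λ(x) = exp(2πi tr(x)/3)` of a finite field of
characteristic `3`, where `tr` is the trace to `𝔽₃`. -/
def canonicalChar (F : Type*) [Field F] [Algebra (ZMod 3) F] : AddChar F ℂ :=
  (ZMod.stdAddChar (N := 3)).compAddMonoidHom (Algebra.trace (ZMod 3) F).toAddMonoidHom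

/-- The Kloosterman sum `K(ψ;a) = ∑_{α ≠ 0} ψ(α + a α⁻¹)`. -/
def kloosterman {F : Type*} [Field F] [Fintype F] [DecidableEq F] (ψ : AddChar F ℂ) (a : F) : ℂ :=
  ∑ α : Fˣ, ψ ((α : F) + a * (α : F)⁻¹)

/-- The ternary linear code `{u ∈ 𝔽₃^N | u · v = 0}` attached to `v ∈ 𝔽_q^N`. -/
def ternaryCode {F : Type*} [Field F] [Algebra (ZMod 3) F] {N : ℕ} (v : Fin N → F) :
    Submodule (ZMod 3) (Fin N → ZMod 3) where
  carrier := {u | ∑ j, algebraMap (ZMod 3) F (u j) * v j = 0}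
  add_mem' := by
    intro x y hx hy
    simp only [Set.mem_ofPred_eq, Pi.add_apply, map_add, add_mul, Finset.sum_add_distrib] at *
    rw [hx, hy, add_zero]
  zero_mem' := by simp
  smul_mem' := by
    intro c x hx
    simp only [Set.mem_ofPred_eq, Pi.smul_apply, smul_eq_mul, map_mul, mul_assoc,
      ← Finset.mul_sum] at *
    rw [hx, mul_zero]

/-- The dual `C^⊥` of a ternary linear code. -/
def dualCode {N : ℕ} (C : Submodule (ZMod 3) (Fin N → ZMod 3)) :
    Submodule (ZMod 3) (Fin N → ZMod 3) where
  carrier := {x | ∀ u ∈ C, x ⬝ᵥ u = 0}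
  add_mem' := by
    intro x y hx hy u hu
    rw [add_dotProduct, hx u hu, hy u hu, add_zero]
  zero_mem' := by
    intro u _
    exact zero_dotProduct u
  smul_mem' := by
    intro c x hx u hu
    rw [smul_dotProduct, hx u hu, smul_zero]

/-- The vector `(Tr g₁, …, Tr g_N)` of an ordering `g₁, …, g_N` of a finite set `D` of matrices. -/
def traceVector {F : Type*} [Field F] {n N : ℕ}
    {D : Set (Matrix (BlockIdx n) (BlockIdx n) F)} (g : Fin N ≃ D) : Fin N → F :=
  fun j => Matrix.trace (g j : Matrix (BlockIdx n) (BlockIdx n) F)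

/-- The word `c(a) = (tr(a Tr g₁), …, tr(a Tr g_N)) ∈ 𝔽₃^N`. -/
def codeword {F : Type*} [Field F] [Algebra (ZMod 3) F] {n N : ℕ}
    {D : Set (Matrix (BlockIdx n) (BlockIdx n) F)} (g : Fin N ≃ D) (a : F) : Fin N → ZMod 3 :=
  fun j => Algebra.trace (ZMod 3) F (a * traceVector g j)

end TernaryKloosterman

end

open Matrix Finset

set_option linter.unusedSectionVars false

/-! For a coordinate `x = a Tr g`, the identity `1 + ω + ω² = 0` for a primitive cube root of unity
makes `(2 - λ(x) - λ(-x))/3` the indicator of `tr(x) ≠ 0`. The weight is therefore determined by the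
size of the double coset and by two character sums over it, for `a` and for `-a`
(`hammingNorm_codeword`).

The map `(x, y) ↦ x σ y` on `Q × Q` has fibres of constant size `|Q ∩ σQσ|`, and the trace is
cyclic, so a sum over the coset becomes a sum of `ψ(Tr(w τ σ))` over `w ∈ Q` alone
(`card_stabFin_mul_sum_cosetFin`). Here `τ = diag(1, 1, ε)` with `ε = ±1` handles the cosets with
and without `ρ` together; it only contributes a factor `ψ(ε)`, and the factors for `a` and `-a` add
up to `2 Re λ(a)`.

In characteristic 3 the condition on `B` says `B = ᵗh h + X` with `X` skew-symmetric, so `Q` has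
free coordinates `(A, X, h)`. Let `r = 2m` be the number of exchanged indices. Summing over `X`
kills every `A` except those with symmetric leading `r × r` block and zero block to its right.
Summing over `h` gives the Gauss sum of the quadratic form of the leading block, and the total of
these over all nondegenerate forms in even dimension is just the number of forms
(`sum_symmInv_gauss`): the corner entry of a random invertible symmetric matrix of even size is
equidistributed in `F`. What remains is a Kloosterman sum over `GL(k)`, `k = n - r`, which is `K`
for `k = 1` and `q(K² + q² - q)` for `k = 2` (`klGL_of_card_eq_two`). These steps make up
`parabolicSum_blocks`.

The closed forms for `A` and `B` then follow from the orders of `Q`, of its intersection with `σQσ`,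
and of the set of invertible symmetric matrices. -/

namespace TernaryKloosterman

/-! ### Invertible symmetric matrices: their number, the law of a corner entry, and the total of
their Gauss sums. -/

section Symmetric

variable {F : Type*} [Field F] [Fintype F] [DecidableEq F]
variable {ι κ μ : Type*} [Fintype ι] [DecidableEq ι] [Fintype κ] [DecidableEq κ]
  [Fintype μ] [DecidableEq μ]

/-- An invertible matrix can move any nonzero vector to any other one. -/
theorem exists_mulVec_eq {v w : ι → F} (hv : v ≠ 0) (hw : w ≠ 0) :
    ∃ P : Matrix ι ι F, P.det ≠ 0 ∧ P *ᵥ v = w := by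
  obtain ⟨g, hg⟩ := Submodule.exists_linearEquiv_restrict_eq
    ((LinearEquiv.toSpanNonzeroSingleton F _ v hv).symm ≪≫ₗ
      LinearEquiv.toSpanNonzeroSingleton F _ w hw)
  refine ⟨LinearMap.toMatrix' (g : (ι → F) →ₗ[F] (ι → F)), ?_, ?_⟩
  · rw [LinearMap.det_toMatrix']
    exact (LinearEquiv.isUnit_det' g).ne_zero
  · rw [LinearMap.toMatrix'_mulVec]
    have h := hg ⟨v, Submodule.mem_span_singleton_self v⟩
    have h1 : (⟨v, Submodule.mem_span_singleton_self v⟩ : Submodule.span F {v}) =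
        LinearEquiv.toSpanNonzeroSingleton F _ v hv 1 := by
      ext; simp
    rw [h1, LinearEquiv.trans_apply, LinearEquiv.symm_apply_apply] at h
    simpa using h.symm

variable (F ι) in
/-- The invertible symmetric matrices. -/
def symmInv : Finset (Matrix ι ι F) := univ.filter fun A => Aᵀ = A ∧ A.det ≠ 0

theorem mem_symmInv {A : Matrix ι ι F} : A ∈ symmInv F ι ↔ Aᵀ = A ∧ A.det ≠ 0 := by
  simp [symmInv]

theorem sum_symmInv_reindex {R : Type*} [AddCommMonoid R] (e : ι ≃ κ) (f : Matrix ι ι F → R) :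
    ∑ A ∈ symmInv F ι, f A = ∑ A ∈ symmInv F κ, f (A.submatrix e e) := by
  refine sum_nbij' (fun A => A.submatrix e.symm e.symm) (fun A => A.submatrix e e) ?_ ?_ ?_ ?_ ?_
  · intro A hA
    rw [mem_symmInv] at hA ⊢
    rw [transpose_submatrix, hA.1, det_submatrix_equiv_self]
    exact ⟨rfl, hA.2⟩
  · intro A hA
    rw [mem_symmInv] at hA ⊢
    rw [transpose_submatrix, hA.1, det_submatrix_equiv_self]
    exact ⟨rfl, hA.2⟩
  · intro A _; simp
  · intro A _; simp
  · intro A _; simp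

theorem card_symmInv_congr (e : ι ≃ κ) : #(symmInv F ι) = #(symmInv F κ) := by
  simpa using sum_symmInv_reindex (F := F) (R := ℕ) e fun _ => 1

variable (F) in
/-- The number of invertible symmetric matrices of size `n`. -/
def symmCount (n : ℕ) : ℕ := #(symmInv F (Fin n))

theorem card_symmInv : #(symmInv F ι) = symmCount F (Fintype.card ι) :=
  card_symmInv_congr (Fintype.equivFin ι)

theorem sum_symmInv_congruence {R : Type*} [AddCommMonoid R] (P : Matrix ι ι F) (hP : P.det ≠ 0)
    (f : Matrix ι ι F → R) :
    ∑ A ∈ symmInv F ι, f A = ∑ A ∈ symmInv F ι, f (Pᵀ * A * P) := by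
  have hu : IsUnit P.det := hP.isUnit
  have hut : IsUnit Pᵀ.det := by rwa [det_transpose]
  refine (sum_nbij' (fun A => Pᵀ * A * P) (fun A => Pᵀ⁻¹ * A * P⁻¹) ?_ ?_ ?_ ?_ ?_).symm
  · intro A hA
    rw [mem_symmInv] at hA ⊢
    refine ⟨by simp [hA.1, Matrix.mul_assoc], ?_⟩
    simp [hA.2, hP]
  · intro A hA
    rw [mem_symmInv] at hA ⊢
    refine ⟨by simp [hA.1, Matrix.mul_assoc, transpose_nonsing_inv], ?_⟩
    simp [hA.2, hP, det_nonsing_inv]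
  · intro A _
    rw [Matrix.mul_assoc Pᵀ, nonsing_inv_mul_cancel_left _ _ hut, mul_nonsing_inv_cancel_right _ _ hu]
  · intro A _
    rw [Matrix.mul_assoc Pᵀ⁻¹, mul_nonsing_inv_cancel_left _ _ hut, nonsing_inv_mul_cancel_right _ _ hu]
  · intro A _; rfl

/-- The symmetric matrix `[c ᵗv; v C]`. -/
def bordered (c : F) (v : κ → F) (C : Matrix κ κ F) : Matrix (Unit ⊕ κ) (Unit ⊕ κ) F :=
  fromBlocks (of fun _ _ => c) (of fun _ j => v j) (of fun i _ => v i) C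

theorem bordered_transpose (c : F) (v : κ → F) (C : Matrix κ κ F) :
    (bordered c v C)ᵀ = bordered c v Cᵀ := by
  ext (i | i) (j | j) <;> simp [bordered]

theorem bordered_surj {A : Matrix (Unit ⊕ κ) (Unit ⊕ κ) F} (h : Aᵀ = A) :
    A = bordered (A (.inl ()) (.inl ())) (fun i => A (.inr i) (.inl ())) A.toBlocks₂₂ := by
  ext (i | i) (j | j)
  · simp [bordered]
  · simp [bordered]
    conv_lhs => rw [← h]
    rfl
  · simp [bordered]
  · simp [bordered, toBlocks₂₂]

/-- Schur complement of the `1 × 1` corner. -/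
theorem det_bordered {c : F} (hc : c ≠ 0) (v : κ → F) (C : Matrix κ κ F) :
    (bordered c v C).det = c * (C - c⁻¹ • vecMulVec v v).det := by
  let : Invertible (of fun _ _ => c : Matrix Unit Unit F) :=
    ⟨of fun _ _ => c⁻¹, by ext i j; simp [Matrix.mul_apply, hc], by
      ext i j; simp [Matrix.mul_apply, hc]⟩
  rw [bordered, det_fromBlocks₁₁]
  congr 1
  · simp
  · congr 2
    ext i j
    change ((of fun i _ => v i) * (of fun _ _ => c⁻¹ : Matrix Unit Unit F) *
      (of fun _ j => v j) : Matrix κ κ F) i j = _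
    simp [Matrix.mul_apply, vecMulVec]
    ring

/-- Once the corner is a unit, the border `v` is arbitrary and the Schur complement `C - c⁻¹ v ᵗv`
ranges freely over the invertible symmetric matrices of the smaller size. -/
theorem card_symmInv_corner {c : F} (hc : c ≠ 0) :
    #((symmInv F (Unit ⊕ κ)).filter fun A => A (.inl ()) (.inl ()) = c) =
      Fintype.card F ^ Fintype.card κ * #(symmInv F κ) := by
  have : Fintype.card F ^ Fintype.card κ * #(symmInv F κ) =
      #((univ : Finset (κ → F)) ×ˢ symmInv F κ) := by simp [card_product]
  rw [this]
  have hsym (v : κ → F) : (vecMulVec v v)ᵀ = vecMulVec v v := by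
    ext i j; simp [vecMulVec, mul_comm]
  refine card_nbij' (fun A => (fun i => A (.inr i) (.inl ()),
      A.toBlocks₂₂ - c⁻¹ • vecMulVec (fun i => A (.inr i) (.inl ())) fun i => A (.inr i) (.inl ())))
    (fun p => bordered c p.1 (p.2 + c⁻¹ • vecMulVec p.1 p.1)) ?_ ?_ ?_ ?_
  · intro A hA
    simp only [coe_filter, Set.mem_ofPred_eq, mem_symmInv] at hA
    obtain ⟨⟨h1, h2⟩, h3⟩ := hA
    simp only [coe_product, Set.mem_prod, mem_coe, mem_univ, true_and, mem_symmInv]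
    rw [bordered_surj h1, h3, det_bordered hc] at h2
    refine ⟨?_, (mul_ne_zero_iff.1 h2).2⟩
    rw [transpose_sub, transpose_smul, hsym]
    congr 1
    conv_rhs => rw [← h1]
    rfl
  · rintro ⟨v, C⟩ hp
    simp only [coe_product, Set.mem_prod, mem_coe, mem_univ, true_and, mem_symmInv] at hp
    simp only [coe_filter, Set.mem_ofPred_eq, mem_symmInv]
    refine ⟨⟨?_, ?_⟩, by simp [bordered]⟩
    · rw [bordered_transpose, transpose_add, transpose_smul, hsym, hp.1]
    · rw [det_bordered hc, add_sub_cancel_right]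
      exact mul_ne_zero hc hp.2
  · intro A hA
    simp only [coe_filter, Set.mem_ofPred_eq, mem_symmInv] at hA
    obtain ⟨⟨h1, h2⟩, h3⟩ := hA
    dsimp only
    rw [sub_add_cancel]
    conv_rhs => rw [bordered_surj h1, h3]
  · rintro ⟨v, C⟩ _
    simp [bordered]

/-- The symmetric matrices `C` for which `[0 ᵗv; v C]` is invertible. -/
def cornerZero (v : κ → F) : Finset (Matrix κ κ F) :=
  univ.filter fun C => Cᵀ = C ∧ (bordered 0 v C).det ≠ 0

theorem cornerZero_zero : cornerZero (0 : κ → F) = ∅ := by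
  refine filter_eq_empty_iff.2 fun C _ h => h.2 ?_
  exact det_eq_zero_of_row_eq_zero (.inl ()) (by rintro (i | i) <;> simp [bordered])

/-- Congruence by `diag(1, P)` keeps the zero corner and replaces the border `v` by `P v`, so any
nonzero border can be exchanged for a convenient one. -/
theorem card_cornerZero_congr {v w : κ → F} (hv : v ≠ 0) (hw : w ≠ 0) :
    #(cornerZero v) = #(cornerZero w) := by
  have key : ∀ {v w : κ → F}, v ≠ 0 → w ≠ 0 → #(cornerZero v) ≤ #(cornerZero w) := by
    intro v w hv hw
    obtain ⟨P, hP, rfl⟩ := exists_mulVec_eq hv hw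
    have hu : IsUnit P.det := hP.isUnit
    have hut : IsUnit Pᵀ.det := by rwa [det_transpose]
    refine card_le_card_of_injOn (fun C => P * C * Pᵀ) ?_ ?_
    · intro C hC
      simp only [cornerZero, coe_filter, mem_univ, true_and, Set.mem_ofPred_eq] at hC ⊢
      refine ⟨by simp [hC.1, Matrix.mul_assoc], ?_⟩
      have : bordered 0 (P *ᵥ v) (P * C * Pᵀ) =
          fromBlocks 1 0 0 P * bordered 0 v C * (fromBlocks 1 0 0 P)ᵀ := by
        simp only [bordered, fromBlocks_multiply, fromBlocks_transpose]
        congr 1 <;> ext i j <;> simp [Matrix.mul_apply, mulVec, dotProduct, mul_comm]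
      rw [this]
      simp [hC.2, hP]
    · intro C _ D _ h
      have h' := congrArg (fun X => P⁻¹ * X * Pᵀ⁻¹) h
      dsimp only at h'
      rwa [Matrix.mul_assoc P, Matrix.mul_assoc P, nonsing_inv_mul_cancel_left _ _ hu,
        nonsing_inv_mul_cancel_left _ _ hu, mul_nonsing_inv_cancel_right _ _ hut,
        mul_nonsing_inv_cancel_right _ _ hut] at h'
  exact (key hv hw).antisymm (key hw hv)

/-- Schur complement of the leading block `J = [0 1; 1 d]`, of determinant `-1`. The correction term
vanishes because `w` only meets the lower right entry of `J⁻¹ = [-d 1; 1 0]`, which is zero. -/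
theorem det_bordered_zero_single (d : F) (w : μ → F) (C : Matrix μ μ F) :
    (bordered 0 (Sum.elim (fun _ : Unit => (1 : F)) 0) (bordered d w C)).det = -C.det := by
  let J : Matrix (Unit ⊕ Unit) (Unit ⊕ Unit) F :=
    fromBlocks 0 1 1 (of fun _ _ => d)
  let : Invertible J :=
    ⟨fromBlocks (of fun _ _ => -d) 1 1 0, by
      ext (i | i) (j | j) <;> simp [J, fromBlocks_multiply], by
      ext (i | i) (j | j) <;> simp [J, fromBlocks_multiply]⟩
  have hJ : J.det = -1 := by
    rw [← det_submatrix_equiv_self (finTwoEquiv.trans Equiv.boolEquivPUnitSumPUnit), det_fin_two]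
    simp [J, finTwoEquiv, Equiv.boolEquivPUnitSumPUnit]
  have : bordered 0 (Sum.elim (fun _ : Unit => (1 : F)) 0) (bordered d w C) =
      (fromBlocks J (fromRows 0 (of fun _ j => w j)) (fromCols 0 (of fun i _ => w i)) C).submatrix
        (Equiv.sumAssoc Unit Unit μ).symm (Equiv.sumAssoc Unit Unit μ).symm := by
    ext (i | i | i) (j | j | j) <;> simp [bordered, J]
  rw [this, det_submatrix_equiv_self, det_fromBlocks₁₁, hJ, neg_one_mul]
  congr 3
  rw [sub_eq_self]
  change fromCols 0 (of fun i _ => w i) * fromBlocks (of fun _ _ => -d) 1 1 0 * _ = _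
  ext i j
  simp [Matrix.mul_apply, Fintype.sum_sum_type]

/-- With the border moved to the first basis vector, invertibility only depends on the block left
after removing two rows and columns; the entry `d` and the vector `w` are free, which accounts for
the power of `q`. -/
theorem card_cornerZero {v : Unit ⊕ μ → F} (hv : v ≠ 0) :
    #(cornerZero v) = Fintype.card F ^ (Fintype.card μ + 1) * #(symmInv F μ) := by
  have h1 : (Sum.elim (fun _ : Unit => (1 : F)) 0 : Unit ⊕ μ → F) ≠ 0 := fun h => by
    simpa using congrFun h (.inl ())
  rw [card_cornerZero_congr hv h1]
  have : Fintype.card F ^ (Fintype.card μ + 1) * #(symmInv F μ) =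
      #((univ : Finset (F × (μ → F))) ×ˢ symmInv F μ) := by
    simp [card_product, pow_succ, mul_comm]
  rw [this]
  refine card_nbij' (fun A => ((A (.inl ()) (.inl ()), fun i => A (.inr i) (.inl ())),
      A.toBlocks₂₂)) (fun p => bordered p.1.1 p.1.2 p.2) ?_ ?_ ?_ ?_
  · intro A hA
    simp only [cornerZero, coe_filter, Set.mem_ofPred_eq, mem_univ, true_and] at hA
    simp only [coe_product, Set.mem_prod, mem_coe, mem_univ, true_and, mem_symmInv]
    obtain ⟨h1, h2⟩ := hA
    rw [bordered_surj h1, det_bordered_zero_single] at h2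
    refine ⟨?_, neg_ne_zero.1 h2⟩
    conv_rhs => rw [← h1]
    rfl
  · rintro ⟨⟨d, w⟩, C⟩ hp
    simp only [coe_product, Set.mem_prod, mem_coe, mem_univ, true_and, mem_symmInv] at hp
    simp only [cornerZero, coe_filter, Set.mem_ofPred_eq, mem_univ, true_and]
    rw [bordered_transpose, det_bordered_zero_single, hp.1]
    exact ⟨rfl, neg_ne_zero.2 hp.2⟩
  · intro A hA
    simp only [cornerZero, coe_filter, Set.mem_ofPred_eq, mem_univ, true_and] at hA
    exact (bordered_surj hA.1).symm
  · rintro ⟨⟨d, w⟩, C⟩ _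
    simp [bordered]

theorem card_symmInv_corner_zero :
    #((symmInv F (Unit ⊕ κ)).filter fun A => A (.inl ()) (.inl ()) = 0) =
      ∑ v : κ → F, #(cornerZero v) := by
  rw [← card_sigma]
  refine card_nbij' (fun A => ⟨fun i => A (.inr i) (.inl ()), A.toBlocks₂₂⟩)
    (fun p => bordered 0 p.1 p.2) ?_ ?_ ?_ ?_
  · intro A hA
    simp only [coe_filter, Set.mem_ofPred_eq, mem_symmInv] at hA
    obtain ⟨⟨h1, h2⟩, h3⟩ := hA
    simp only [cornerZero, mem_coe, mem_sigma, mem_univ, true_and, mem_filter]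
    rw [bordered_surj h1, h3] at h2
    refine ⟨?_, h2⟩
    conv_rhs => rw [← h1]
    rfl
  · rintro ⟨v, C⟩ hp
    simp only [cornerZero, mem_coe, mem_sigma, mem_univ, true_and, mem_filter] at hp
    simp only [coe_filter, Set.mem_ofPred_eq, mem_symmInv]
    refine ⟨⟨?_, hp.2⟩, by simp [bordered]⟩
    rw [bordered_transpose, hp.1]
  · intro A hA
    simp only [coe_filter, Set.mem_ofPred_eq, mem_symmInv] at hA
    obtain ⟨⟨h1, h2⟩, h3⟩ := hA
    conv_rhs => rw [bordered_surj h1, h3]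
  · rintro ⟨v, C⟩ _
    simp [bordered]

theorem card_symmInv_corner_zero_unit_sum :
    (#((symmInv F (Unit ⊕ (Unit ⊕ μ))).filter fun A => A (.inl ()) (.inl ()) = 0) : ℂ) =
      ((Fintype.card F : ℂ) ^ (Fintype.card μ + 1) - 1) *
        ((Fintype.card F : ℂ) ^ (Fintype.card μ + 1) * #(symmInv F μ)) := by
  rw [card_symmInv_corner_zero, ← add_sum_erase _ _ (mem_univ 0), cornerZero_zero, card_empty,
    zero_add, sum_congr rfl fun v hv => card_cornerZero (ne_of_mem_erase hv), sum_const,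
    card_erase_of_mem (mem_univ _), card_univ, Fintype.card_fun, Fintype.card_sum, Fintype.card_unit,
    smul_eq_mul, add_comm 1, Nat.cast_mul, Nat.cast_sub (Nat.one_le_pow _ _ Fintype.card_pos)]
  push_cast
  ring

/-- Summing a function of the corner entry over the invertible symmetric matrices. -/
theorem sum_symmInv_corner (φ : F → ℂ) :
    ∑ A ∈ symmInv F (Unit ⊕ κ), φ (A (.inl ()) (.inl ())) =
      φ 0 * #((symmInv F (Unit ⊕ κ)).filter fun A => A (.inl ()) (.inl ()) = 0) +
        (∑ c ∈ univ.erase 0, φ c) * ((Fintype.card F : ℂ) ^ Fintype.card κ * #(symmInv F κ)) := by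
  rw [← sum_fiberwise (symmInv F (Unit ⊕ κ)) (fun A => A (.inl ()) (.inl ())),
    ← add_sum_erase _ _ (mem_univ 0), sum_mul]
  have h (c : F) : ∑ A ∈ symmInv F (Unit ⊕ κ) with A (.inl ()) (.inl ()) = c,
      φ (A (.inl ()) (.inl ())) =
      φ c * #((symmInv F (Unit ⊕ κ)).filter fun A => A (.inl ()) (.inl ()) = c) := by
    rw [sum_congr rfl fun A hA => by rw [(mem_filter.1 hA).2], sum_const, nsmul_eq_mul, mul_comm]
  rw [h]
  congr 1
  refine sum_congr rfl fun c hc => ?_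
  rw [h, card_symmInv_corner (ne_of_mem_erase hc)]
  push_cast
  rfl

theorem symmCount_zero : symmCount F 0 = 1 := by
  rw [symmCount, card_eq_one]
  refine ⟨1, ?_⟩
  ext A
  simp [mem_symmInv, Subsingleton.elim A 1]

theorem symmCount_one : (symmCount F 1 : ℂ) = Fintype.card F - 1 := by
  have h := sum_symmInv_corner (F := F) (κ := Empty) fun _ => 1
  have h0 : (symmInv F (Unit ⊕ Empty)).filter (fun A => A (.inl ()) (.inl ()) = 0) = ∅ := by
    rw [← card_eq_zero, card_symmInv_corner_zero, sum_eq_zero]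
    intro v _
    rw [Subsingleton.elim v 0, cornerZero_zero, card_empty]
  rw [h0] at h
  simpa [card_symmInv, symmCount_zero, card_erase_of_mem, Nat.cast_sub Fintype.card_pos] using h

/-- The matrices are split by whether the corner entry vanishes. -/
theorem symmCount_add_two (n : ℕ) : (symmCount F (n + 2) : ℂ) =
    ((Fintype.card F : ℂ) ^ (n + 1) - 1) * ((Fintype.card F : ℂ) ^ (n + 1) * symmCount F n) +
      (Fintype.card F - 1) * ((Fintype.card F : ℂ) ^ (n + 1) * symmCount F (n + 1)) := by
  have h := sum_symmInv_corner (F := F) (κ := Unit ⊕ Fin n) fun _ => 1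
  rw [card_symmInv_corner_zero_unit_sum] at h
  have e : 1 + (n + 1) = n + 2 := by omega
  simpa [card_symmInv, card_erase_of_mem, Nat.cast_sub Fintype.card_pos, e, add_comm 1 n] using h

/-- The two-term recursion collapses to first-order ones depending on parity. The first of them is
exactly what balances zero and nonzero corners in even size. -/
theorem symmCount_pair (m : ℕ) :
    (symmCount F (2 * m + 1) : ℂ) =
        ((Fintype.card F : ℂ) ^ (2 * m + 1) - 1) * symmCount F (2 * m) ∧
      (symmCount F (2 * m + 2) : ℂ) =
        (Fintype.card F : ℂ) ^ (2 * m + 2) * symmCount F (2 * m + 1) := by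
  induction m with
  | zero =>
    have h1 := symmCount_one (F := F)
    have h2 := symmCount_add_two (F := F) 0
    rw [symmCount_zero] at h2
    simp only [mul_zero, zero_add, symmCount_zero] at h1 h2 ⊢
    rw [h2, h1]
    constructor <;> push_cast <;> ring
  | succ m ih =>
    obtain ⟨h1, h2⟩ := ih
    have h3 := symmCount_add_two (F := F) (2 * m + 1)
    have h4 := symmCount_add_two (F := F) (2 * m + 2)
    have h5 : (symmCount F (2 * m + 3) : ℂ) =
        ((Fintype.card F : ℂ) ^ (2 * m + 3) - 1) * symmCount F (2 * m + 2) := by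
      rw [h3, h2]; ring
    refine ⟨h5, ?_⟩
    change (symmCount F (2 * m + 2 + 2) : ℂ) =
      (Fintype.card F : ℂ) ^ (2 * m + 2 + 2) * symmCount F (2 * m + 3)
    rw [h4, h5]; ring

theorem symmCount_even (m : ℕ) : (symmCount F (2 * m) : ℂ) =
    (Fintype.card F : ℂ) ^ (m * (m + 1)) *
      ∏ j ∈ Icc 1 m, ((Fintype.card F : ℂ) ^ (2 * j - 1) - 1) := by
  induction m with
  | zero => simp [symmCount_zero]
  | succ m ih =>
    rw [prod_Icc_succ_top (by omega), show 2 * (m + 1) = 2 * m + 2 by ring, (symmCount_pair m).2,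
      (symmCount_pair m).1, ih, show 2 * m + 2 - 1 = 2 * m + 1 by omega]
    ring

/-- In even size `2m + 2` every value of the corner entry is taken equally often: `0` occurs
`(q^(2m+1) - 1) q^(2m+1) s(2m)` times, each other value `q^(2m+1) s(2m+1)` times, where `s` is
`symmCount`, and these agree by `symmCount_pair`. A nontrivial character then sums to zero. -/
theorem sum_symmInv_corner_addChar (m : ℕ) (hκ : Fintype.card κ = 2 * m + 1)
    {ψ : AddChar F ℂ} (hψ : ψ ≠ 0) :
    ∑ A ∈ symmInv F (Unit ⊕ κ), ψ (A (.inl ()) (.inl ())) = 0 := by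
  obtain ⟨e⟩ : Nonempty (κ ≃ Unit ⊕ Fin (2 * m)) :=
    ⟨Fintype.equivOfCardEq (by simp [hκ, add_comm])⟩
  have he : ∑ c ∈ univ.erase 0, ψ c = -1 := by
    have := AddChar.sum_eq_zero_iff_ne_zero.2 hψ
    rw [← add_sum_erase _ _ (mem_univ 0), AddChar.map_zero_eq_one] at this
    linear_combination this
  rw [sum_symmInv_reindex (Equiv.sumCongr (Equiv.refl Unit) e)]
  simp only [submatrix_apply, Equiv.sumCongr_apply, Sum.map_inl, Equiv.refl_apply]
  rw [sum_symmInv_corner, card_symmInv_corner_zero_unit_sum, he, AddChar.map_zero_eq_one,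
    card_symmInv, card_symmInv]
  simp only [Fintype.card_sum, Fintype.card_unit, Fintype.card_fin, add_comm 1,
    (symmCount_pair m).1]
  ring

/-- In even size, the total of the Gauss sums of all nondegenerate quadratic forms is their
number. -/
theorem sum_symmInv_gauss (m : ℕ) (hκ : Fintype.card κ = 2 * m) {ψ : AddChar F ℂ} (hψ : ψ ≠ 0) :
    ∑ A ∈ symmInv F κ, ∑ h : κ → F, ψ (h ⬝ᵥ A *ᵥ h) = symmCount F (2 * m) := by
  -- With the sum over `h` outside, `h = 0` already gives the claimed total, so every other `h` has
  -- to contribute zero.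
  rw [sum_comm, ← add_sum_erase _ _ (mem_univ 0), sum_eq_zero (s := univ.erase 0)]
  · simp [card_symmInv, hκ]
  intro h hh
  have hh0 := ne_of_mem_erase hh
  obtain ⟨i, hi⟩ := Function.ne_iff.1 hh0
  obtain ⟨k, rfl⟩ : ∃ k, m = k + 1 := by
    have : 0 < Fintype.card κ := Fintype.card_pos_iff.2 ⟨i⟩
    exact ⟨m - 1, by omega⟩
  obtain ⟨e⟩ : Nonempty (κ ≃ Unit ⊕ Fin (2 * k + 1)) :=
    ⟨Fintype.equivOfCardEq (by simp [hκ]; ring)⟩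
  -- Congruence by `P` carrying `h` to a basis vector turns the value of the form at `h` into a
  -- single diagonal entry.
  obtain ⟨P, hP, hPh⟩ := exists_mulVec_eq hh0
    (w := Pi.single (e.symm (.inl ())) 1) (by simp)
  rw [sum_symmInv_congruence P hP]
  have hval (A : Matrix κ κ F) :
      h ⬝ᵥ (Pᵀ * A * P) *ᵥ h = A (e.symm (.inl ())) (e.symm (.inl ())) := by
    rw [← mulVec_mulVec, hPh, ← mulVec_mulVec, dotProduct_mulVec, vecMul_transpose, hPh]
    simp
  simp_rw [hval]
  rw [← sum_symmInv_corner_addChar (κ := Fin (2 * k + 1)) k (by simp) hψ]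
  rw [sum_symmInv_reindex e]
  simp

end Symmetric

/-! ### Orders of general linear groups, and Kloosterman sums over `GL(1)` and `GL(2)`. -/

section GeneralLinear

variable {F : Type*} [Field F] [Fintype F] [DecidableEq F]
variable {ι κ μ : Type*} [Fintype ι] [DecidableEq ι] [Fintype κ] [DecidableEq κ]
  [Fintype μ] [DecidableEq μ]

variable (F ι) in
/-- The invertible matrices. -/
def invMat : Finset (Matrix ι ι F) := univ.filter fun A => A.det ≠ 0

theorem mem_invMat {A : Matrix ι ι F} : A ∈ invMat F ι ↔ A.det ≠ 0 := by simp [invMat]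

theorem sum_invMat_reindex {R : Type*} [AddCommMonoid R] (e : ι ≃ κ) (f : Matrix ι ι F → R) :
    ∑ A ∈ invMat F ι, f A = ∑ A ∈ invMat F κ, f (A.submatrix e e) := by
  refine sum_nbij' (fun A => A.submatrix e.symm e.symm) (fun A => A.submatrix e e) ?_ ?_ ?_ ?_ ?_
  · intro A hA
    rw [mem_invMat] at hA ⊢
    rwa [det_submatrix_equiv_self]
  · intro A hA
    rw [mem_invMat] at hA ⊢
    rwa [det_submatrix_equiv_self]
  · intro A _; simp
  · intro A _; simp
  · intro A _; simp

variable (F) in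
/-- The order of the general linear group of degree `n`. -/
def glCount (n : ℕ) : ℕ := #(invMat F (Fin n))

theorem card_invMat : #(invMat F ι) = glCount F (Fintype.card ι) := by
  simpa [glCount] using sum_invMat_reindex (F := F) (R := ℕ) (Fintype.equivFin ι) fun _ => 1

theorem sum_GL {R : Type*} [AddCommMonoid R] (f : Matrix ι ι F → R) :
    ∑ A : GL ι F, f A = ∑ A ∈ invMat F ι, f A := by
  refine sum_bij (fun A _ => (A : Matrix ι ι F)) ?_ ?_ ?_ ?_
  · intro A _
    rw [mem_invMat]
    exact ((Matrix.isUnit_iff_isUnit_det _).1 A.isUnit).ne_zero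
  · intro A _ B _ h
    exact Units.ext h
  · intro A hA
    exact ⟨GeneralLinearGroup.mkOfDetNeZero A (mem_invMat.1 hA), mem_univ _, rfl⟩
  · intro A _; rfl

theorem glCount_eq (n : ℕ) :
    (glCount F n : ℂ) = ∏ i ∈ range n, ((Fintype.card F : ℂ) ^ n - (Fintype.card F : ℂ) ^ i) := by
  have h : glCount F n = Nat.card (GL (Fin n) F) := by
    rw [Nat.card_eq_fintype_card, glCount]
    simpa using (sum_GL (ι := Fin n) (F := F) (R := ℕ) fun _ => 1).symm
  rw [h, card_GL_field, Nat.cast_prod, ← Fin.prod_univ_eq_prod_range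
    (fun i => ((Fintype.card F : ℂ) ^ n - (Fintype.card F : ℂ) ^ i))]
  refine prod_congr rfl fun i _ => ?_
  rw [Nat.cast_sub (Nat.pow_le_pow_right Fintype.card_pos i.2.le)]
  push_cast
  rfl

theorem glCount_zero : (glCount F 0 : ℂ) = 1 := by simp [glCount_eq]

theorem glCount_succ (n : ℕ) : (glCount F (n + 1) : ℂ) =
    ((Fintype.card F : ℂ) ^ (n + 1) - 1) * (Fintype.card F : ℂ) ^ n * glCount F n := by
  rw [glCount_eq, glCount_eq, prod_range_succ', pow_zero]
  have (i : ℕ) : (Fintype.card F : ℂ) ^ (n + 1) - (Fintype.card F : ℂ) ^ (i + 1) =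
    Fintype.card F * ((Fintype.card F : ℂ) ^ n - (Fintype.card F : ℂ) ^ i) := by ring
  simp_rw [this]
  rw [prod_mul_distrib, prod_const, card_range]
  ring

/-- The Kloosterman sum over the general linear group. -/
noncomputable def klGL (ι : Type*) [Fintype ι] [DecidableEq ι] (ψ : AddChar F ℂ) : ℂ :=
  ∑ A ∈ invMat F ι, ψ (trace A + trace A⁻¹)

theorem trace_submatrix_equiv (e : ι ≃ κ) (A : Matrix κ κ F) :
    trace (A.submatrix e e) = trace A :=
  e.sum_comp fun i => A i i

theorem klGL_congr (e : ι ≃ κ) (ψ : AddChar F ℂ) : klGL ι ψ = klGL κ ψ := by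
  rw [klGL, sum_invMat_reindex e, klGL]
  refine sum_congr rfl fun A _ => ?_
  rw [inv_submatrix_equiv, trace_submatrix_equiv, trace_submatrix_equiv]

theorem kloosterman_one_eq (ψ : AddChar F ℂ) :
    kloosterman ψ 1 = ∑ x ∈ univ.erase (0 : F), ψ (x + x⁻¹) := by
  rw [kloosterman]
  refine sum_bij' (fun u _ => (u : F)) (fun x hx => Units.mk0 x (ne_of_mem_erase hx))
    ?_ ?_ ?_ ?_ ?_
  all_goals simp

/-- Substitute `α ↦ aα`, since `a(α + α⁻¹) = aα + a²(aα)⁻¹`. Only `a²` survives, so `a` and `-a`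
give the same sum. -/
theorem kloosterman_mulShift (ψ : AddChar F ℂ) {a : F} (ha : a ≠ 0) :
    kloosterman (ψ.mulShift a) 1 = kloosterman ψ (a ^ 2) := by
  rw [kloosterman, kloosterman]
  refine Fintype.sum_equiv (Equiv.mulLeft (Units.mk0 a ha)) _ _ fun u => ?_
  rw [AddChar.mulShift_apply]
  congr 1
  simp
  field_simp

theorem klGL_of_card_eq_one (h : Fintype.card ι = 1) (ψ : AddChar F ℂ) :
    klGL ι ψ = kloosterman ψ 1 := by
  obtain ⟨e⟩ : Nonempty (ι ≃ Unit) := ⟨Fintype.equivOfCardEq (by simp [h])⟩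
  rw [klGL_congr e, klGL, kloosterman_one_eq]
  refine sum_nbij' (fun A => A () ()) (fun x => of fun _ _ => x) ?_ ?_ ?_ ?_ ?_
  · intro A hA
    rw [mem_invMat] at hA
    simpa using hA
  · intro A hA
    rw [mem_invMat]
    simpa using hA
  · intro A _; ext; rfl
  · intro x _; rfl
  · intro A _
    simp [trace, Ring.inverse_eq_inv']

/-- For `z ≠ 0` the determinant `D = xw - yz` can replace `y` as a free variable. Summing over `x`
and `w` then vanishes unless `1 + D⁻¹ = 0`, so only `D = -1` counts. -/
theorem sum_addChar_of_lower_left_ne_zero (ψ : AddChar F ℂ) (hψ : ψ ≠ 0) {z : F} (hz : z ≠ 0) :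
    (∑ x : F, ∑ w : F, ∑ y : F, if x * w - y * z ≠ 0 then
      ψ ((x + w) * (1 + (x * w - y * z)⁻¹)) else 0) = (Fintype.card F : ℂ) ^ 2 := by
  have h1 (x w : F) : (∑ y : F, if x * w - y * z ≠ 0 then
      ψ ((x + w) * (1 + (x * w - y * z)⁻¹)) else 0) =
      ∑ D : F, if D ≠ 0 then ψ ((x + w) * (1 + D⁻¹)) else 0 :=
    Fintype.sum_equiv ((Equiv.mulRight₀ z hz).trans (Equiv.subLeft (x * w))) _ _ fun y => by simp
  have hprim : ψ.IsPrimitive := AddChar.IsPrimitive.of_ne_one hψ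
  have h2 (D : F) : (∑ x : F, ∑ w : F, if D ≠ 0 then ψ ((x + w) * (1 + D⁻¹)) else 0) =
      if D = -1 then (Fintype.card F : ℂ) ^ 2 else 0 := by
    have h3 : ∑ x : F, ∑ w : F, ψ ((x + w) * (1 + D⁻¹)) =
        (∑ x : F, ψ (x * (1 + D⁻¹))) * ∑ w : F, ψ (w * (1 + D⁻¹)) := by
      rw [sum_mul_sum]
      simp_rw [add_mul, AddChar.map_add_eq_mul]
    rcases eq_or_ne D 0 with rfl | hD
    · simp
    · simp only [ne_eq, hD, not_false_eq_true, if_true]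
      rw [h3, AddChar.sum_mulShift _ hprim]
      have : 1 + D⁻¹ = 0 ↔ D = -1 := by
        rw [← mul_right_inj' hD, mul_add, mul_inv_cancel₀ hD, mul_zero, mul_one,
          add_eq_zero_iff_eq_neg]
      simp only [this]
      split_ifs <;> simp [sq]
  simp_rw [h1]
  have : (∑ x : F, ∑ w : F, ∑ D : F, if D ≠ 0 then ψ ((x + w) * (1 + D⁻¹)) else 0) =
      ∑ D : F, ∑ x : F, ∑ w : F, if D ≠ 0 then ψ ((x + w) * (1 + D⁻¹)) else 0 := by
    rw [sum_congr rfl fun x _ => sum_comm, sum_comm]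
  rw [this]
  simp_rw [h2]
  simp

/-- For `A = [x y; z w]` of determinant `D`, `Tr A + Tr A⁻¹ = (x + w)(1 + D⁻¹)`. Each of the `q - 1`
nonzero values of `z` contributes `q²`; for `z = 0` the sum factors over the diagonal entries and
gives `K²`, with `y` free. -/
theorem klGL_of_card_eq_two (h : Fintype.card ι = 2) (ψ : AddChar F ℂ) (hψ : ψ ≠ 0) :
    klGL ι ψ = Fintype.card F *
      (kloosterman ψ 1 ^ 2 + (Fintype.card F : ℂ) ^ 2 - Fintype.card F) := by
  rw [klGL_congr (Fintype.equivFinOfCardEq h), klGL, invMat, sum_filter]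
  have h1 : (∑ A : Matrix (Fin 2) (Fin 2) F,
      if A.det ≠ 0 then ψ (trace A + trace A⁻¹) else 0) =
      ∑ z : F, ∑ x : F, ∑ w : F, ∑ y : F, if x * w - y * z ≠ 0 then
        ψ ((x + w) * (1 + (x * w - y * z)⁻¹)) else 0 := by
    simp_rw [← Fintype.sum_prod_type']
    refine (Fintype.sum_equiv (Equiv.mk (fun p : F × F × F × F => !![p.2.1, p.2.2.2; p.1, p.2.2.1])
      (fun A => (A 1 0, A 0 0, A 1 1, A 0 1)) (fun p => by simp)
      (fun A => by ext i j; fin_cases i <;> fin_cases j <;> rfl)) _ _ fun p => ?_).symm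
    obtain ⟨z, x, w, y⟩ := p
    simp only [Equiv.coe_fn_mk, det_fin_two_of, Matrix.inv_def, adjugate_fin_two_of, trace_smul,
      trace_fin_two_of, Ring.inverse_eq_inv', smul_eq_mul]
    congr 2
    ring
  rw [h1, ← add_sum_erase _ _ (mem_univ 0),
    sum_congr rfl fun z hz => sum_addChar_of_lower_left_ne_zero ψ hψ (ne_of_mem_erase hz)]
  have h2 : (∑ x : F, ∑ w : F, ∑ y : F, if x * w - y * 0 ≠ 0 then
        ψ ((x + w) * (1 + (x * w - y * 0)⁻¹)) else 0) =
      Fintype.card F * kloosterman ψ 1 ^ 2 := by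
    rw [sq, kloosterman_one_eq, sum_mul_sum, mul_sum, ← filter_ne', sum_filter]
    refine sum_congr rfl fun x _ => ?_
    split_ifs with hx
    · rw [mul_sum, sum_filter]
      refine sum_congr rfl fun w _ => ?_
      split_ifs with hw
      · rw [sum_congr rfl (g := fun _ => ψ (x + x⁻¹) * ψ (w + w⁻¹))]
        · simp
        · intro y _
          rw [if_pos (by simp [hx, hw]), ← AddChar.map_add_eq_mul]
          congr 1
          field_simp
          ring
      · simp [not_not.1 hw]
    · simp [not_not.1 hx]
  rw [h2, sum_const, card_erase_of_mem (mem_univ _), nsmul_eq_mul, card_univ,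
    Nat.cast_sub Fintype.card_pos]
  push_cast
  ring

end GeneralLinear

/-! ### Skew-symmetric matrices: orthogonality of characters and counting. -/

section Alternating

variable {F : Type*} [Field F] [Fintype F] [DecidableEq F]
variable {ι κ μ : Type*} [Fintype ι] [DecidableEq ι] [Fintype κ] [DecidableEq κ]
  [Fintype μ] [DecidableEq μ]

variable (F ι) in
/-- The skew-symmetric matrices. -/
def skew : AddSubgroup (Matrix ι ι F) where
  carrier := {X | Xᵀ = -X}
  add_mem' := by
    intro X Y hX hY
    simp only [Set.mem_ofPred_eq, transpose_add] at *
    rw [hX, hY, neg_add]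
  zero_mem' := by simp
  neg_mem' := by
    intro X hX
    simp only [Set.mem_ofPred_eq, transpose_neg] at *
    rw [hX]

theorem mem_skew {X : Matrix ι ι F} : X ∈ skew F ι ↔ Xᵀ = -X := Iff.rfl

instance : DecidablePred (· ∈ skew F ι) := fun _ => decidable_of_iff _ mem_skew.symm

/-- `X ↦ ψ(Tr(MX))` is a character of the group of skew-symmetric matrices, and it is trivial
exactly when `M` is symmetric. -/
theorem sum_skew_addChar (h2 : (2 : F) ≠ 0) {ψ : AddChar F ℂ} (hψ : ψ ≠ 0) (M : Matrix ι ι F) :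
    ∑ X : skew F ι, ψ (trace (M * (X : Matrix ι ι F))) =
      if Mᵀ = M then (Fintype.card (skew F ι) : ℂ) else 0 := by
  let χ : AddChar (skew F ι) ℂ := ψ.compAddMonoidHom
    ((traceAddMonoidHom ι F).comp ((AddMonoidHom.mulLeft M).comp (skew F ι).subtype))
  have hχ (X : skew F ι) : χ X = ψ (trace (M * (X : Matrix ι ι F))) := rfl
  split_ifs with hM
  · rw [sum_congr rfl (g := fun _ => 1)]
    · simp
    · rintro ⟨X, hX⟩ _
      rw [mem_skew] at hX
      have h1 : trace (M * X) = -trace (M * X) := by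
        conv_lhs => rw [← trace_transpose, transpose_mul, hX, hM, neg_mul, trace_neg, trace_mul_comm]
      have h3 : 2 * trace (M * X) = 0 := by linear_combination h1
      rw [(mul_eq_zero.1 h3).resolve_left h2, AddChar.map_zero_eq_one]
  · simp_rw [← hχ]
    rw [AddChar.sum_eq_zero_iff_ne_zero, AddChar.ne_zero_iff]
    obtain ⟨c, hc⟩ := AddChar.ne_zero_iff.1 hψ
    obtain ⟨i, j, hij⟩ : ∃ i j, M i j ≠ M j i := by
      by_contra! h
      exact hM (Matrix.ext fun i j => h j i)
    -- This elementary skew matrix is scaled so that `Tr(MX) = c`, where `ψ c ≠ 1`.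
    refine ⟨⟨single j i (c / (M i j - M j i)) - single i j (c / (M i j - M j i)), ?_⟩, ?_⟩
    · rw [mem_skew]
      simp
    · rw [hχ]
      have : M i j - M j i ≠ 0 := sub_ne_zero.2 hij
      rw [mul_sub, trace_sub, trace_mul_single, trace_mul_single]
      simp only [MulOpposite.smul_eq_mul_unop, MulOpposite.unop_op]
      convert hc using 2
      field_simp

/-- Skew-symmetric matrices by blocks. -/
def skewEquiv : skew F (κ ⊕ μ) ≃ skew F κ × Matrix κ μ F × skew F μ where
  toFun X := (⟨X.1.toBlocks₁₁, by
      rw [mem_skew]; ext i j; exact congrFun₂ X.2 (.inl i) (.inl j)⟩,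
    X.1.toBlocks₁₂, ⟨X.1.toBlocks₂₂, by
      rw [mem_skew]; ext i j; exact congrFun₂ X.2 (.inr i) (.inr j)⟩)
  invFun p := ⟨fromBlocks p.1 p.2.1 (-p.2.1ᵀ) p.2.2, by
    rw [mem_skew, fromBlocks_transpose, mem_skew.1 p.1.2, mem_skew.1 p.2.2.2, fromBlocks_neg]
    simp⟩
  left_inv X := by
    ext (i | i) (j | j)
    · rfl
    · rfl
    · have := congrFun₂ X.2 (.inr i) (.inl j)
      simp only [transpose_apply, Matrix.neg_apply] at this
      simp [toBlocks₁₂, this]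
    · rfl
  right_inv p := by
    ext <;> simp

theorem card_matrix_eq :
    Fintype.card (Matrix κ μ F) = Fintype.card F ^ (Fintype.card κ * Fintype.card μ) :=
  (Fintype.card_congr (Equiv.refl (κ → μ → F))).trans (by simp [← pow_mul, mul_comm])

theorem card_skew_sum : Fintype.card (skew F (κ ⊕ μ)) = Fintype.card (skew F κ) *
    (Fintype.card F ^ (Fintype.card κ * Fintype.card μ) * Fintype.card (skew F μ)) := by
  rw [Fintype.card_congr skewEquiv, Fintype.card_prod, Fintype.card_prod, card_matrix_eq]

theorem card_skew_corner_zero :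
    #(univ.filter fun X : skew F (κ ⊕ μ) => (X : Matrix (κ ⊕ μ) (κ ⊕ μ) F).toBlocks₁₁ = 0) =
      Fintype.card F ^ (Fintype.card κ * Fintype.card μ) * Fintype.card (skew F μ) := by
  have : Fintype.card F ^ (Fintype.card κ * Fintype.card μ) * Fintype.card (skew F μ) =
      #(univ : Finset (Matrix κ μ F × skew F μ)) := by
    rw [card_univ, Fintype.card_prod, card_matrix_eq]
  rw [this]
  refine card_nbij' (fun X => (skewEquiv X).2) (fun p => skewEquiv.symm (0, p)) ?_ ?_ ?_ ?_
  · intro X _; simp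
  · intro p _; simp [skewEquiv]
  · intro X hX
    simp only [coe_filter, mem_univ, true_and, Set.mem_ofPred_eq] at hX
    have : (0, (skewEquiv X).2) = skewEquiv X := Prod.ext (Subtype.ext hX.symm) rfl
    dsimp only
    rw [this, Equiv.symm_apply_apply]
  · intro p _; simp

/-- Relabelling the rows and columns of a skew-symmetric matrix. -/
def skewReindex (e : ι ≃ κ) : skew F ι ≃ skew F κ where
  toFun X := ⟨X.1.submatrix e.symm e.symm, by
    rw [mem_skew, transpose_submatrix, mem_skew.1 X.2]; rfl⟩
  invFun X := ⟨X.1.submatrix e e, by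
    rw [mem_skew, transpose_submatrix, mem_skew.1 X.2]; rfl⟩
  left_inv X := by ext; simp
  right_inv X := by ext; simp

theorem card_skew_congr (e : ι ≃ κ) : Fintype.card (skew F ι) = Fintype.card (skew F κ) :=
  Fintype.card_congr (skewReindex e)

theorem card_skew (h2 : (2 : F) ≠ 0) :
    Fintype.card (skew F ι) = Fintype.card F ^ (Fintype.card ι).choose 2 := by
  rw [card_skew_congr (Fintype.equivFin ι)]
  induction Fintype.card ι with
  | zero => simpa using Fintype.card_le_one_iff_subsingleton.2 inferInstance |>.antisymm Fintype.card_pos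
  | succ n ih =>
    have h1 : Fintype.card (skew F (Fin 1)) = 1 := by
      rw [Fintype.card_eq_one_iff]
      refine ⟨0, fun X => ?_⟩
      ext i j
      have := congrFun₂ X.2 i j
      rw [Subsingleton.elim j i, transpose_apply, Matrix.neg_apply] at *
      have h3 : 2 * X.1 i i = 0 := by linear_combination this
      simpa using (mul_eq_zero.1 h3).resolve_left h2
    rw [card_skew_congr finSumFinEquiv.symm, card_skew_sum, ih, h1, Nat.choose_succ_succ' n 1]
    simp [pow_add, mul_comm]

end Alternating

/-! ### Evaluation of the exponential sum in the coordinates `(A, X, h)`, and the coordinates of the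
stabilizer. -/

section ParabolicSum

variable {F : Type*} [Field F] [Fintype F] [DecidableEq F]
variable {ι κ μ : Type*} [Fintype ι] [DecidableEq ι] [Fintype κ] [DecidableEq κ]
  [Fintype μ] [DecidableEq μ]

/-- The exponential sum over the parabolic subgroup, in terms of its Levi and unipotent
coordinates; `d` is the indicator of the indices exchanged by the Weyl element. -/
noncomputable def parabolicSum (ψ : AddChar F ℂ) (d : ι → F) : ℂ :=
  ∑ A ∈ invMat F ι, ∑ X : skew F ι, ∑ h : ι → F,
    ψ (trace (diagonal d * A * (vecMulVec h h + (X : Matrix ι ι F))) +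
      trace (diagonal (1 - d) * (A + A⁻¹)))

theorem parabolicSum_reindex (e : ι ≃ κ) (ψ : AddChar F ℂ) (d : ι → F) :
    parabolicSum ψ d = parabolicSum ψ (d ∘ e.symm) := by
  rw [parabolicSum, sum_invMat_reindex e, parabolicSum]
  refine sum_congr rfl fun A _ => Fintype.sum_equiv (skewReindex e) _ _ fun X =>
    Fintype.sum_equiv (Equiv.arrowCongr e (Equiv.refl F)) _ _ fun h => ?_
  rw [← trace_submatrix_equiv e (_ * _), ← trace_submatrix_equiv e (diagonal _ * (A + A⁻¹)),
    ← submatrix_mul_equiv _ _ e e e, ← submatrix_mul_equiv _ _ e e e,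
    ← submatrix_mul_equiv _ _ e e e, submatrix_add, submatrix_add, inv_submatrix_equiv]
  have h1 : (diagonal (d ∘ e.symm)).submatrix e e = diagonal d := by
    ext i j; simp [diagonal_apply]
  have h2 : (diagonal (1 - d ∘ e.symm)).submatrix e e = diagonal (1 - d) := by
    ext i j; simp [diagonal_apply]
  have h3 : (vecMulVec (Equiv.arrowCongr e (Equiv.refl F) h)
      (Equiv.arrowCongr e (Equiv.refl F) h)).submatrix e e = vecMulVec h h := by
    ext i j; simp [vecMulVec]
  have h4 : (skewReindex e X).1.submatrix e e = X.1 := by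
    ext; simp [skewReindex]
  simp only [Pi.add_apply, h1, h2, h3, h4]

/-- The invertible block triangular matrices with symmetric leading block. -/
theorem sum_invMat_symm_corner {R : Type*} [AddCommMonoid R]
    (f : Matrix (κ ⊕ μ) (κ ⊕ μ) F → R) :
    (∑ A ∈ invMat F (κ ⊕ μ), if (fromBlocks A.toBlocks₁₁ A.toBlocks₁₂ 0 0)ᵀ =
        (fromBlocks A.toBlocks₁₁ A.toBlocks₁₂ 0 0 : Matrix (κ ⊕ μ) (κ ⊕ μ) F) then f A else 0) =
      ∑ A ∈ symmInv F κ, ∑ D ∈ invMat F μ, ∑ C : Matrix μ κ F, f (fromBlocks A 0 C D) := by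
  rw [← sum_filter]
  simp_rw [← sum_product' (s := invMat F μ), ← sum_product']
  refine sum_nbij' (fun A => (A.toBlocks₁₁, A.toBlocks₂₂, A.toBlocks₂₁))
    (fun p => fromBlocks p.1 0 p.2.2 p.2.1) ?_ ?_ ?_ ?_ ?_
  · intro A hA
    simp only [mem_filter, fromBlocks_transpose, fromBlocks_inj, mem_invMat,
      transpose_zero] at hA
    obtain ⟨h1, h2, h3, -, -⟩ := hA
    rw [← fromBlocks_toBlocks A, ← h3, det_fromBlocks_zero₁₂] at h1
    simp only [mem_product, mem_symmInv, mem_invMat, mem_univ, and_true]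
    exact ⟨⟨h2, left_ne_zero_of_mul h1⟩, right_ne_zero_of_mul h1⟩
  · intro p hp
    simp only [mem_product, mem_symmInv, mem_invMat, mem_univ, and_true] at hp
    simp only [mem_filter, mem_invMat, det_fromBlocks_zero₁₂]
    exact ⟨mul_ne_zero hp.1.2 hp.2, by simp [fromBlocks_transpose, hp.1.1]⟩
  · intro A hA
    simp only [mem_filter, fromBlocks_transpose, fromBlocks_inj, mem_invMat,
      transpose_zero] at hA
    obtain ⟨h1, h2, h3, -, -⟩ := hA
    dsimp only
    conv_rhs => rw [← fromBlocks_toBlocks A, ← h3]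
  · intro p _
    simp
  · intro A hA
    simp only [mem_filter, fromBlocks_transpose, fromBlocks_inj, mem_invMat,
      transpose_zero] at hA
    obtain ⟨h1, h2, h3, -, -⟩ := hA
    dsimp only
    conv_lhs => rw [← fromBlocks_toBlocks A, ← h3]

/-- Summing over `X` forces `d A` to be symmetric, that is, `A = [A₁ 0; C D]` with `A₁` symmetric.
The summand then does not involve `C` or the second part of `h`, whence two powers of `q`. The Gauss
sums of `A₁` total `symmCount F (2 * m)`, and the diagonal block `D` leaves the Kloosterman sum over
the general linear group. -/
theorem parabolicSum_blocks (h2 : (2 : F) ≠ 0) {ψ : AddChar F ℂ} (hψ : ψ ≠ 0) (m : ℕ)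
    (hκ : Fintype.card κ = 2 * m) :
    parabolicSum ψ (Sum.elim (1 : κ → F) (0 : μ → F)) =
      Fintype.card (skew F (κ ⊕ μ)) * (Fintype.card F : ℂ) ^ (Fintype.card μ) *
        (Fintype.card F : ℂ) ^ (Fintype.card μ * Fintype.card κ) * symmCount F (2 * m) *
        klGL μ ψ := by
  have hd : diagonal (Sum.elim (1 : κ → F) (0 : μ → F)) = fromBlocks 1 0 0 0 := by
    ext (i | i) (j | j) <;> simp [diagonal_apply, Matrix.one_apply]
  have hd' : diagonal (1 - Sum.elim (1 : κ → F) (0 : μ → F)) = fromBlocks 0 0 0 1 := by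
    ext (i | i) (j | j) <;> simp [diagonal_apply, Matrix.one_apply]
  have hE (A : Matrix (κ ⊕ μ) (κ ⊕ μ) F) : fromBlocks 1 0 0 0 * A =
      fromBlocks A.toBlocks₁₁ A.toBlocks₁₂ 0 0 := by
    conv_lhs => rw [← fromBlocks_toBlocks A, fromBlocks_multiply]
    simp
  rw [parabolicSum, hd, hd']
  have h1 (A : Matrix (κ ⊕ μ) (κ ⊕ μ) F) : (∑ X : skew F (κ ⊕ μ), ∑ h : κ ⊕ μ → F,
      ψ (trace (fromBlocks 1 0 0 0 * A * (vecMulVec h h + (X : Matrix _ _ F))) +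
        trace (fromBlocks 0 0 0 1 * (A + A⁻¹)))) =
      if (fromBlocks A.toBlocks₁₁ A.toBlocks₁₂ 0 0)ᵀ =
        (fromBlocks A.toBlocks₁₁ A.toBlocks₁₂ 0 0 : Matrix (κ ⊕ μ) (κ ⊕ μ) F) then
      Fintype.card (skew F (κ ⊕ μ)) *
        ((∑ h : κ ⊕ μ → F, ψ (trace (fromBlocks 1 0 0 0 * A * vecMulVec h h))) *
          ψ (trace (fromBlocks 0 0 0 1 * (A + A⁻¹)))) else 0 := by
    rw [← ite_zero_mul, ← hE, ← sum_skew_addChar h2 hψ, sum_mul]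
    refine sum_congr rfl fun X _ => ?_
    rw [sum_mul, mul_sum]
    refine sum_congr rfl fun h _ => ?_
    rw [mul_add, trace_add, AddChar.map_add_eq_mul, AddChar.map_add_eq_mul]
    ring
  rw [sum_congr rfl fun A _ => h1 A, sum_invMat_symm_corner]
  have h3 (A : Matrix κ κ F) (C : Matrix μ κ F) (D : Matrix μ μ F) :
      ∑ h : κ ⊕ μ → F, ψ (trace (fromBlocks 1 0 0 0 * fromBlocks A 0 C D * vecMulVec h h)) =
        (Fintype.card F : ℂ) ^ (Fintype.card μ) * ∑ h : κ → F, ψ (h ⬝ᵥ A *ᵥ h) := by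
    rw [← (Equiv.sumArrowEquivProdArrow κ μ F).symm.sum_comp, Fintype.sum_prod_type, mul_sum]
    refine sum_congr rfl fun h _ => ?_
    rw [sum_congr rfl (g := fun _ => ψ (h ⬝ᵥ A *ᵥ h))]
    · simp
    intro k _
    congr 1
    rw [hE, mul_vecMulVec, trace_vecMulVec, dotProduct_comm, fromBlocks_mulVec]
    simp [dotProduct, Function.comp_def]
  have h4 (A : Matrix κ κ F) (C : Matrix μ κ F) (D : Matrix μ μ F) (hA : A.det ≠ 0)
      (hD : D.det ≠ 0) : trace (fromBlocks 0 0 0 1 * (fromBlocks A 0 C D + (fromBlocks A 0 C D)⁻¹)) =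
        trace D + trace D⁻¹ := by
    rw [inv_fromBlocks_zero₁₂_of_isUnit_iff, fromBlocks_add, fromBlocks_multiply]
    · simp [trace, Fintype.sum_sum_type, sum_add_distrib]
    · simp [Matrix.isUnit_iff_isUnit_det, hA, hD]
  rw [← sum_symmInv_gauss (κ := κ) m hκ hψ, klGL, mul_sum (symmInv F κ), sum_mul]
  refine sum_congr rfl fun A hA => ?_
  rw [mul_sum]
  refine sum_congr rfl fun D hD => ?_
  rw [sum_congr rfl fun C _ => by
    rw [h3, h4 A C D (mem_symmInv.1 hA).2 (mem_invMat.1 hD)]]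
  rw [sum_const, card_univ, card_matrix_eq, nsmul_eq_mul]
  push_cast
  ring

open Classical in
/-- The coordinates of the elements of the parabolic subgroup that stay in it under conjugation
by the Weyl element. -/
noncomputable def stabCoords (p : ι → Prop) :
    Finset (Matrix ι ι F × skew F ι × (ι → F)) :=
  univ.filter fun t => t.1.det ≠ 0 ∧ (∀ i j, p i → ¬ p j → t.1 i j = 0) ∧
    (∀ i, p i → t.2.2 i = 0) ∧ ∀ i j, p i → p j → t.2.1.1 i j = 0

theorem card_stabCoords_congr (e : ι ≃ κ) (p : ι → Prop) (p' : κ → Prop)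
    (h : ∀ i, p i ↔ p' (e i)) :
    #(stabCoords (F := F) p) = #(stabCoords (F := F) p') := by
  refine card_equiv (Equiv.prodCongr (Matrix.reindex e e) (Equiv.prodCongr (skewReindex e)
    (Equiv.arrowCongr e (Equiv.refl F)))) ?_
  rintro ⟨A, X, v⟩
  simp only [stabCoords, mem_filter, mem_univ, true_and, Equiv.prodCongr_apply, Prod.map_apply,
    reindex_apply, submatrix_apply, Equiv.arrowCongr_apply, skewReindex, h]
  simp [e.symm.forall_congr_left]

theorem card_stabCoords_blocks :
    #(stabCoords (F := F) (fun i : κ ⊕ μ => i.isLeft)) =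
      #(invMat F κ) * #(invMat F μ) * Fintype.card F ^ (Fintype.card μ * Fintype.card κ) *
        #(univ.filter fun X : skew F (κ ⊕ μ) =>
          (X : Matrix (κ ⊕ μ) (κ ⊕ μ) F).toBlocks₁₁ = 0) *
        Fintype.card F ^ Fintype.card μ := by
  have : #(invMat F κ) * #(invMat F μ) * Fintype.card F ^ (Fintype.card μ * Fintype.card κ) *
        #(univ.filter fun X : skew F (κ ⊕ μ) =>
          (X : Matrix (κ ⊕ μ) (κ ⊕ μ) F).toBlocks₁₁ = 0) *
        Fintype.card F ^ Fintype.card μ =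
      #((((invMat F κ ×ˢ invMat F μ) ×ˢ (univ : Finset (Matrix μ κ F))) ×ˢ
        (univ.filter fun X : skew F (κ ⊕ μ) => (X : Matrix (κ ⊕ μ) (κ ⊕ μ) F).toBlocks₁₁ = 0)) ×ˢ
        (univ : Finset (μ → F))) := by
    simp only [card_product, card_univ, card_matrix_eq, Fintype.card_fun]
  rw [this]
  refine card_nbij' (fun t => ((((t.1.toBlocks₁₁, t.1.toBlocks₂₂), t.1.toBlocks₂₁), t.2.1),
      fun i => t.2.2 (.inr i)))
    (fun s => (fromBlocks s.1.1.1.1 0 s.1.1.2 s.1.1.1.2, s.1.2, Sum.elim 0 s.2)) ?_ ?_ ?_ ?_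
  · rintro ⟨A, X, v⟩ ht
    simp only [stabCoords, coe_filter, mem_univ, true_and, Set.mem_ofPred_eq, Sum.forall] at ht
    simp at ht
    obtain ⟨h1, h2, h3, h4⟩ := ht
    have hA : A.toBlocks₁₂ = 0 := by ext i j; exact h2 i j
    rw [← fromBlocks_toBlocks A, hA, det_fromBlocks_zero₁₂] at h1
    simp only [mem_coe, mem_product, mem_invMat, mem_univ, mem_filter, and_true, true_and]
    exact ⟨⟨left_ne_zero_of_mul h1, right_ne_zero_of_mul h1⟩, by ext i j; exact h4 i j⟩
  · rintro ⟨⟨⟨⟨A, D⟩, C⟩, X⟩, v⟩ hs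
    simp only [mem_coe, mem_product, mem_invMat, mem_univ, mem_filter, and_true, true_and] at hs
    simp only [stabCoords, coe_filter, mem_univ, true_and, Set.mem_ofPred_eq, Sum.forall]
    simp
    exact ⟨⟨hs.1.1, hs.1.2⟩, fun i j => congrFun₂ hs.2 i j⟩
  · rintro ⟨A, X, v⟩ ht
    simp only [stabCoords, coe_filter, mem_univ, true_and, Set.mem_ofPred_eq, Sum.forall] at ht
    simp at ht
    obtain ⟨h1, h2, h3, h4⟩ := ht
    have hA : A.toBlocks₁₂ = 0 := by ext i j; exact h2 i j
    refine Prod.ext ?_ (Prod.ext rfl ?_)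
    · conv_rhs => rw [← fromBlocks_toBlocks A, hA]
    · ext (i | i)
      · exact (h3 i).symm
      · rfl
  · rintro ⟨⟨⟨⟨A, D⟩, C⟩, X⟩, v⟩ _
    simp

end ParabolicSum

/-! ### The group structure of `Q`. -/

section Parabolic

variable {F : Type*} [Field F] {n : ℕ}

variable (F n) in
/-- The Gram matrix of the quadratic form. -/
def gram : Matrix (BlockIdx n) (BlockIdx n) F :=
  fromBlocks (fromBlocks 0 1 1 0) 0 0 1

/-- A matrix with the zero pattern of the parabolic subgroup. -/
def pattern (A B D : Matrix (Fin n) (Fin n) F) (c : Matrix (Fin n) (Fin 1) F)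
    (h : Matrix (Fin 1) (Fin n) F) : Matrix (BlockIdx n) (BlockIdx n) F :=
  fromBlocks (fromBlocks A B 0 D) (fromRows c 0) (fromCols 0 h) 1

theorem pattern_inj {A B D A' B' D' : Matrix (Fin n) (Fin n) F} {c c' : Matrix (Fin n) (Fin 1) F}
    {h h' : Matrix (Fin 1) (Fin n) F} :
    pattern A B D c h = pattern A' B' D' c' h' ↔ A = A' ∧ B = B' ∧ D = D' ∧ c = c' ∧ h = h' := by
  simp only [pattern, fromBlocks_inj, fromRows_inj.eq_iff, fromCols_inj.eq_iff]
  tauto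

theorem pattern_mul (A B D A' B' D' : Matrix (Fin n) (Fin n) F) (c c' : Matrix (Fin n) (Fin 1) F)
    (h h' : Matrix (Fin 1) (Fin n) F) :
    pattern A B D c h * pattern A' B' D' c' h' =
      pattern (A * A') (A * B' + B * D' + c * h') (D * D') (A * c' + c) (h * D' + h') := by
  rw [pattern, pattern, pattern, fromBlocks_multiply, fromBlocks_multiply]
  congr 1
  · rw [fromRows_mul_fromCols, fromBlocks_add]
    simp
  · ext (i | i) j <;> simp [fromBlocks_mul_fromRows]
  · ext i (j | j) <;> simp [fromCols_mul_fromBlocks]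
  · simp [fromCols_mul_fromRows]

theorem pattern_gram (A B D : Matrix (Fin n) (Fin n) F) (c : Matrix (Fin n) (Fin 1) F)
    (h : Matrix (Fin 1) (Fin n) F) :
    (pattern A B D c h)ᵀ * gram F n * pattern A B D c h = gram F n ↔
      Aᵀ * D = 1 ∧ Dᵀ * B + Bᵀ * D + hᵀ * h = 0 ∧ Dᵀ * c + hᵀ = 0 := by
  have key : (pattern A B D c h)ᵀ * gram F n * pattern A B D c h =
      fromBlocks (fromBlocks 0 (Aᵀ * D) (Dᵀ * A) (Dᵀ * B + Bᵀ * D + hᵀ * h))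
        (fromRows 0 (Dᵀ * c + hᵀ)) (fromCols 0 (cᵀ * D + h)) 1 := by
    simp only [pattern, gram, fromBlocks_transpose, transpose_fromRows, transpose_fromCols,
      fromBlocks_multiply]
    congr 1
    · simp only [transpose_zero]
      ext (i | i) (j | j) <;> simp [fromBlocks_multiply]
    · ext (i | i) j <;> simp [fromBlocks_mul_fromRows]
    · ext i (j | j) <;> simp [fromCols_mul_fromBlocks]
    · simp [fromCols_mul_fromBlocks, fromCols_mul_fromRows]
  have hz1 : (0 : Matrix (Fin n ⊕ Fin n) (Fin 1) F) = fromRows 0 0 := by simp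
  have hz2 : (0 : Matrix (Fin 1) (Fin n ⊕ Fin n) F) = fromCols 0 0 := by simp
  rw [key, gram, fromBlocks_inj, fromBlocks_inj, hz1, hz2, fromRows_inj.eq_iff,
    fromCols_inj.eq_iff]
  have e1 : Dᵀ * A = 1 ↔ Aᵀ * D = 1 := by
    rw [← transpose_inj, transpose_mul, transpose_transpose, transpose_one]
  have e2 : cᵀ * D + h = 0 ↔ Dᵀ * c + hᵀ = 0 := by
    rw [← transpose_inj, transpose_add, transpose_mul, transpose_transpose, transpose_zero]
  rw [e1, e2]
  tauto

theorem factored_eq_pattern (A D B : Matrix (Fin n) (Fin n) F) (h : Matrix (Fin 1) (Fin n) F) :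
    fromBlocks (fromBlocks A 0 0 D) 0 0 1 *
        fromBlocks (fromBlocks 1 B 0 1) (fromRows (-h.transpose) 0) (fromCols 0 h) 1 =
      pattern A (A * B) D (-(A * hᵀ)) h := by
  rw [pattern, fromBlocks_multiply]
  congr 1
  · simp [fromBlocks_multiply]
  · ext (i | i) j <;> simp [fromBlocks_mul_fromRows]
  · simp
  · simp

/-- `Q` is the set of isometries of the quadratic form having a certain zero pattern. Both
conditions are visibly stable under products, unlike the factored form of the definition. -/
theorem mem_subgroupQ_iff_gram {w : Matrix (BlockIdx n) (BlockIdx n) F} :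
    w ∈ subgroupQ F n ↔ wᵀ * gram F n * w = gram F n ∧
      ∃ A B D c h, w = pattern A B D c h := by
  constructor
  · rintro ⟨A, B, h, hB, rfl⟩
    rw [factored_eq_pattern]
    refine ⟨(pattern_gram ..).2 ⟨?_, ?_, ?_⟩, _, _, _, _, _, rfl⟩
    · rw [← transpose_mul, ← Units.val_mul, inv_mul_cancel, Units.val_one, transpose_one]
    · rw [transpose_transpose, ← Matrix.mul_assoc, ← Units.val_mul, inv_mul_cancel, Units.val_one,
        Matrix.one_mul, transpose_mul, Matrix.mul_assoc, ← transpose_mul, ← Units.val_mul,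
        inv_mul_cancel, Units.val_one, transpose_one, Matrix.mul_one, hB]
    · rw [transpose_transpose, Matrix.mul_neg, ← Matrix.mul_assoc, ← Units.val_mul, inv_mul_cancel,
        Units.val_one, Matrix.one_mul, neg_add_cancel]
  · rintro ⟨h1, A, B, D, c, h, rfl⟩
    rw [pattern_gram] at h1
    obtain ⟨h1, h2, h3⟩ := h1
    have h4 : A * Dᵀ = 1 := by
      rw [← transpose_inj, transpose_mul, transpose_transpose, transpose_one, mul_eq_one_comm, h1]
    have h5 : Dᵀ * A = 1 := mul_eq_one_comm.1 h4
    refine ⟨⟨A, Dᵀ, h4, h5⟩, Dᵀ * B, h, ?_, ?_⟩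
    · rw [transpose_mul, transpose_transpose, h2]
    · rw [factored_eq_pattern, pattern_inj]
      refine ⟨rfl, ?_, ?_, ?_, rfl⟩
      · rw [← Matrix.mul_assoc, h4, Matrix.one_mul]
      · simp
      · rw [eq_neg_of_add_eq_zero_right h3, Matrix.mul_neg, neg_neg, ← Matrix.mul_assoc, h4,
          Matrix.one_mul]

theorem mul_mem_subgroupQ {w w' : Matrix (BlockIdx n) (BlockIdx n) F} (hw : w ∈ subgroupQ F n)
    (hw' : w' ∈ subgroupQ F n) : w * w' ∈ subgroupQ F n := by
  rw [mem_subgroupQ_iff_gram] at *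
  obtain ⟨h1, A, B, D, c, h, rfl⟩ := hw
  obtain ⟨h1', A', B', D', c', h', rfl⟩ := hw'
  refine ⟨?_, _, _, _, _, _, pattern_mul ..⟩
  rw [transpose_mul, Matrix.mul_assoc, Matrix.mul_assoc, ← Matrix.mul_assoc (gram F n),
    ← Matrix.mul_assoc _ (gram F n * _), ← Matrix.mul_assoc _ (gram F n), h1, ← Matrix.mul_assoc, h1']

theorem gram_mul_gram : gram F n * gram F n = 1 := by
  simp [gram, fromBlocks_multiply]

theorem mul_inv_of_mem_subgroupQ {w : Matrix (BlockIdx n) (BlockIdx n) F}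
    (hw : w ∈ subgroupQ F n) : w * w⁻¹ = 1 := by
  have h := (mem_subgroupQ_iff_gram.1 hw).1
  have h1 : (gram F n * wᵀ * gram F n) * w = 1 := by
    rw [Matrix.mul_assoc, Matrix.mul_assoc, ← Matrix.mul_assoc wᵀ, h, gram_mul_gram]
  rw [inv_eq_left_inv h1, mul_eq_one_comm.1 h1]

theorem inv_mul_of_mem_subgroupQ {w : Matrix (BlockIdx n) (BlockIdx n) F}
    (hw : w ∈ subgroupQ F n) : w⁻¹ * w = 1 :=
  mul_eq_one_comm.1 (mul_inv_of_mem_subgroupQ hw)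

theorem one_mem_subgroupQ : (1 : Matrix (BlockIdx n) (BlockIdx n) F) ∈ subgroupQ F n := by
  rw [mem_subgroupQ_iff_gram]
  refine ⟨by simp, 1, 0, 1, 0, 0, ?_⟩
  simp [pattern]

/-- By finiteness: left multiplication by `w` is injective on `Q`, hence hits `1`. -/
theorem inv_mem_subgroupQ [Finite F] {w : Matrix (BlockIdx n) (BlockIdx n) F} (hw : w ∈ subgroupQ F n) :
    w⁻¹ ∈ subgroupQ F n := by
  have hinj : Function.Injective
      fun y : subgroupQ F n => (⟨w * y, mul_mem_subgroupQ hw y.2⟩ : subgroupQ F n) := by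
    intro x y hxy
    have h := congrArg (fun z => w⁻¹ * z) (congrArg Subtype.val hxy)
    dsimp only at h
    rw [← Matrix.mul_assoc, ← Matrix.mul_assoc, inv_mul_of_mem_subgroupQ hw, Matrix.one_mul,
      Matrix.one_mul] at h
    exact Subtype.ext h
  obtain ⟨y, hy⟩ := Finite.injective_iff_surjective.1 hinj ⟨1, one_mem_subgroupQ⟩
  rw [inv_eq_right_inv (congrArg Subtype.val hy)]
  exact y.2

end Parabolic

/-! ### Free coordinates on `Q`, and conjugation by `σ` in these coordinates. -/

section Coordinates

variable {F : Type*} [Field F] [Fintype F] [DecidableEq F] {n : ℕ}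

/-- The element of the parabolic subgroup with given coordinates. -/
noncomputable def qElem (A X : Matrix (Fin n) (Fin n) F) (h : Fin n → F) :
    Matrix (BlockIdx n) (BlockIdx n) F :=
  pattern A (A * (vecMulVec h h + X)) A⁻¹ᵀ (-(A * (replicateRow (Fin 1) h)ᵀ))
    (replicateRow (Fin 1) h)

theorem transpose_mul_replicateRow (h : Fin n → F) :
    (replicateRow (Fin 1) h)ᵀ * replicateRow (Fin 1) h = vecMulVec h h := by
  ext i j; simp [Matrix.mul_apply, vecMulVec]

/-- In characteristic 3, `B = ᵗh h` is a particular solution of `B + ᵗB + ᵗh h = 0`, since the left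
side becomes `3 ᵗh h`. The other solutions differ from it by a skew-symmetric matrix. -/
theorem mem_subgroupQ_iff_qElem [CharP F 3] {w : Matrix (BlockIdx n) (BlockIdx n) F} :
    w ∈ subgroupQ F n ↔ ∃ A X, ∃ h : Fin n → F, A.det ≠ 0 ∧ X ∈ skew F (Fin n) ∧ w = qElem A X h := by
  have h3 : (3 : F) = 0 := by exact_mod_cast CharP.cast_eq_zero F 3
  have hv (h : Fin n → F) : (vecMulVec h h)ᵀ = vecMulVec h h := by
    ext i j; simp [vecMulVec, mul_comm]
  have h3v (h : Fin n → F) : vecMulVec h h + vecMulVec h h + vecMulVec h h = 0 := by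
    ext i j
    simp only [Matrix.add_apply, Matrix.zero_apply]
    linear_combination vecMulVec h h i j * h3
  constructor
  · rintro ⟨A, B, h, hB, rfl⟩
    obtain ⟨h, rfl⟩ : ∃ h', h = replicateRow (Fin 1) h' :=
      ⟨h 0, by ext i j; rw [Subsingleton.elim i 0]; rfl⟩
    rw [transpose_mul_replicateRow] at hB
    refine ⟨A, B - vecMulVec h h, h, ((isUnit_iff_isUnit_det _).1 A.isUnit).ne_zero, ?_, ?_⟩
    · rw [mem_skew, transpose_sub, hv, neg_sub]
      have : Bᵀ = - B - vecMulVec h h := by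
        rw [eq_sub_iff_add_eq, eq_neg_iff_add_eq_zero, ← hB]; abel
      rw [this, ← sub_eq_zero, ← neg_zero, ← h3v h]
      abel
    · rw [factored_eq_pattern, qElem, add_sub_cancel, coe_units_inv]
  · rintro ⟨A, X, h, hA, hX, rfl⟩
    refine ⟨GeneralLinearGroup.mkOfDetNeZero A hA, vecMulVec h h + X, replicateRow (Fin 1) h, ?_, ?_⟩
    · rw [transpose_mul_replicateRow, transpose_add, hv, mem_skew.1 hX, ← h3v h]
      abel
    · rw [factored_eq_pattern, qElem, coe_units_inv]
      rfl

open Classical in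
variable (F n) in
/-- The parabolic subgroup as a finite set. -/
noncomputable def qFin : Finset (Matrix (BlockIdx n) (BlockIdx n) F) :=
  univ.filter (· ∈ subgroupQ F n)

theorem mem_qFin {w : Matrix (BlockIdx n) (BlockIdx n) F} : w ∈ qFin F n ↔ w ∈ subgroupQ F n := by
  simp [qFin]

theorem qElem_inj {A X A' X' : Matrix (Fin n) (Fin n) F} {h h' : Fin n → F} (hA : A.det ≠ 0) :
    qElem A X h = qElem A' X' h' ↔ A = A' ∧ X = X' ∧ h = h' := by
  constructor
  · intro H
    rw [qElem, qElem, pattern_inj] at H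
    obtain ⟨rfl, h2, -, -, h5⟩ := H
    have hh : h = h' := funext fun j => congrFun₂ h5 0 j
    subst hh
    have := congrArg (fun M => A⁻¹ * M) h2
    rw [nonsing_inv_mul_cancel_left _ _ hA.isUnit, nonsing_inv_mul_cancel_left _ _ hA.isUnit] at this
    exact ⟨rfl, add_left_cancel this, rfl⟩
  · rintro ⟨rfl, rfl, rfl⟩
    rfl

theorem sum_qFin [CharP F 3] {R : Type*} [AddCommMonoid R]
    (f : Matrix (BlockIdx n) (BlockIdx n) F → R) :
    ∑ w ∈ qFin F n, f w = ∑ A ∈ invMat F (Fin n), ∑ X : skew F (Fin n), ∑ h : Fin n → F,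
      f (qElem A X h) := by
  simp_rw [← Fintype.sum_prod_type', ← sum_product']
  symm
  refine sum_bij (fun t _ => qElem t.1 t.2.1 t.2.2) ?_ ?_ ?_ ?_
  · rintro ⟨A, X, h⟩ ht
    simp only [mem_product, mem_univ, and_true, mem_invMat] at ht
    exact mem_qFin.2 (mem_subgroupQ_iff_qElem.2 ⟨A, X, h, ht, X.2, rfl⟩)
  · rintro ⟨A, X, h⟩ ht ⟨A', X', h'⟩ _ H
    simp only [mem_product, mem_univ, and_true, mem_invMat] at ht
    obtain ⟨h1, h2, h3⟩ := (qElem_inj ht).1 H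
    exact Prod.ext h1 (Prod.ext (Subtype.ext h2) h3)
  · intro w hw
    obtain ⟨A, X, h, hA, hX, rfl⟩ := mem_subgroupQ_iff_qElem.1 (mem_qFin.1 hw)
    exact ⟨(A, ⟨X, hX⟩, h), by simp [mem_invMat, hA], rfl⟩
  · intro t _; rfl

theorem card_qFin [CharP F 3] : #(qFin F n) = glCount F n *
    (Fintype.card (skew F (Fin n)) * Fintype.card F ^ n) := by
  have h := sum_qFin (F := F) (n := n) (R := ℕ) fun _ => 1
  rw [card_eq_sum_ones, h]
  simp [glCount]

/-- The permutation of the indices underlying `sigma`. -/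
def swapIdx (r : ℕ) : BlockIdx n → BlockIdx n
  | .inl (.inl i) => if (i : ℕ) < r then .inl (.inr i) else .inl (.inl i)
  | .inl (.inr i) => if (i : ℕ) < r then .inl (.inl i) else .inl (.inr i)
  | .inr i => .inr i

theorem swapIdx_swapIdx (r : ℕ) (x : BlockIdx n) : swapIdx r (swapIdx r x) = x := by
  rcases x with (i | i) | i
  · by_cases h : (i : ℕ) < r <;> simp [swapIdx, h]
  · by_cases h : (i : ℕ) < r <;> simp [swapIdx, h]
  · rfl

/-- `swapIdx` as an equivalence. -/
def swapEquiv (r : ℕ) : BlockIdx n ≃ BlockIdx n :=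
  ⟨swapIdx r, swapIdx r, swapIdx_swapIdx r, swapIdx_swapIdx r⟩

theorem sigma_eq_submatrix (r : ℕ) :
    sigma F n r = (1 : Matrix (BlockIdx n) (BlockIdx n) F).submatrix (swapEquiv r) id := by
  ext ((i | i) | i) ((j | j) | j)
  all_goals
    by_cases h : (i : ℕ) < r <;> simp [sigma, swapEquiv, swapIdx, diagonal_apply, Matrix.one_apply, h]

theorem sigma_mul_mul_sigma (r : ℕ) (w : Matrix (BlockIdx n) (BlockIdx n) F) :
    sigma F n r * w * sigma F n r = w.submatrix (swapIdx r) (swapIdx r) := by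
  have h1 : sigma F n r * w = w.submatrix (swapIdx r) id := by
    rw [sigma_eq_submatrix]
    exact one_submatrix_mul (swapEquiv r) (Equiv.refl _) w
  rw [h1, sigma_eq_submatrix, mul_submatrix_one]
  rfl

theorem sigma_mul_sigma (r : ℕ) : sigma F n r * sigma F n r = 1 := by
  have h := sigma_mul_mul_sigma (F := F) (n := n) r 1
  rw [Matrix.mul_one] at h
  rw [h]
  exact submatrix_one_equiv (swapEquiv r)

theorem exists_eq_pattern_iff {w : Matrix (BlockIdx n) (BlockIdx n) F} :
    (∃ A B D c h, w = pattern A B D c h) ↔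
      (∀ i j, w (.inl (.inr i)) (.inl (.inl j)) = 0) ∧ (∀ i, w (.inl (.inr i)) (.inr 0) = 0) ∧
        (∀ j, w (.inr 0) (.inl (.inl j)) = 0) ∧ w (.inr 0) (.inr 0) = 1 := by
  constructor
  · rintro ⟨A, B, D, c, h, rfl⟩
    simp [pattern]
  · rintro ⟨h1, h2, h3, h4⟩
    refine ⟨w.toBlocks₁₁.toBlocks₁₁, w.toBlocks₁₁.toBlocks₁₂, w.toBlocks₁₁.toBlocks₂₂,
      w.toBlocks₁₂.toRows₁, w.toBlocks₂₁.toCols₂, ?_⟩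
    ext ((i | i) | i) ((j | j) | j)
    all_goals try rw [Subsingleton.elim i 0]
    all_goals try rw [Subsingleton.elim j 0]
    all_goals simp [pattern, h1, h2, h3, h4, toBlocks₁₁, toBlocks₁₂, toBlocks₂₂, toBlocks₂₁]

/-- `σ` is itself an isometry, so after conjugation only the zero pattern has to be checked. -/
theorem sigma_mul_mul_sigma_mem_iff (r : ℕ) {w : Matrix (BlockIdx n) (BlockIdx n) F}
    (hw : w ∈ subgroupQ F n) : sigma F n r * w * sigma F n r ∈ subgroupQ F n ↔
      ∃ A B D c h, w.submatrix (swapIdx r) (swapIdx r) = pattern A B D c h := by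
  have hg : (gram F n).submatrix (swapEquiv r) (swapEquiv r) = gram F n := by
    ext ((i | i) | i) ((j | j) | j)
    all_goals
      by_cases h : (i : ℕ) < r <;> by_cases h' : (j : ℕ) < r <;>
        simp [gram, swapEquiv, swapIdx, Matrix.one_apply, h, h'] <;> grind
  rw [mem_subgroupQ_iff_gram, sigma_mul_mul_sigma]
  refine and_iff_right ?_
  have h := congrArg (fun M => M.submatrix (swapEquiv r) (swapEquiv r))
    (mem_subgroupQ_iff_gram.1 hw).1
  rwa [← submatrix_mul_equiv _ _ _ (swapEquiv r), ← submatrix_mul_equiv _ _ _ (swapEquiv r),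
    hg] at h

/-- The zero pattern of the conjugate literally gives conditions on `A`, `A⁻¹`, `A(ᵗh h + X)`, `A h`
and `h`. Those on `A⁻¹` and `A h` are redundant, and the one on the product reduces to one on `X`.
-/
theorem stab_iff_coords [CharP F 3] (r : ℕ) {A X : Matrix (Fin n) (Fin n) F} {h : Fin n → F}
    (hA : A.det ≠ 0) (hX : X ∈ skew F (Fin n)) :
    sigma F n r * qElem A X h * sigma F n r ∈ subgroupQ F n ↔
      (∀ i j : Fin n, (i : ℕ) < r → ¬ (j : ℕ) < r → A i j = 0) ∧
      (∀ i : Fin n, (i : ℕ) < r → h i = 0) ∧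
      ∀ i j : Fin n, (i : ℕ) < r → (j : ℕ) < r → X i j = 0 := by
  have hmem : qElem A X h ∈ subgroupQ F n := mem_subgroupQ_iff_qElem.2 ⟨A, X, h, hA, hX, rfl⟩
  have hinv : (∀ i j : Fin n, (i : ℕ) < r → ¬ (j : ℕ) < r → A i j = 0) →
      ∀ i j : Fin n, (i : ℕ) < r → ¬ (j : ℕ) < r → A⁻¹ i j = 0 := by
    intro h1 i j hi hj
    let : Invertible A := A.invertibleOfIsUnitDet hA.isUnit
    -- The labelling makes the vanishing upper right block a block triangularity, which passes to
    -- the inverse.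
    have ht : A.BlockTriangular fun k : Fin n => if (k : ℕ) < r then 1 else 0 := by
      intro k l hkl
      by_cases hk : (k : ℕ) < r <;> by_cases hl : (l : ℕ) < r <;> simp_all
    exact blockTriangular_inv_of_blockTriangular ht (by simp [hi, hj])
  rw [sigma_mul_mul_sigma_mem_iff r hmem, exists_eq_pattern_iff]
  set Y := vecMulVec h h + X with hY
  have key : ((∀ i j, (qElem A X h).submatrix (swapIdx r) (swapIdx r)
        (.inl (.inr i)) (.inl (.inl j)) = 0) ∧
      (∀ i, (qElem A X h).submatrix (swapIdx r) (swapIdx r) (.inl (.inr i)) (.inr 0) = 0) ∧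
      (∀ j, (qElem A X h).submatrix (swapIdx r) (swapIdx r) (.inr 0) (.inl (.inl j)) = 0) ∧
      (qElem A X h).submatrix (swapIdx r) (swapIdx r) (.inr 0) (.inr 0) = 1) ↔
      (∀ i j : Fin n, (i : ℕ) < r → ¬ (j : ℕ) < r → A i j = 0) ∧
      (∀ i j : Fin n, (i : ℕ) < r → ¬ (j : ℕ) < r → A⁻¹ i j = 0) ∧
      (∀ i j : Fin n, (i : ℕ) < r → (j : ℕ) < r → (A * Y) i j = 0) ∧
      (∀ i : Fin n, (i : ℕ) < r → (A *ᵥ h) i = 0) ∧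
      ∀ i : Fin n, (i : ℕ) < r → h i = 0 := by
    have e1 (i j : Fin n) : (qElem A X h).submatrix (swapIdx r) (swapIdx r)
        (.inl (.inr i)) (.inl (.inl j)) =
        if (i : ℕ) < r then (if (j : ℕ) < r then (A * Y) i j else A i j)
        else (if (j : ℕ) < r then A⁻¹ j i else 0) := by
      by_cases hi : (i : ℕ) < r <;> by_cases hj : (j : ℕ) < r <;>
        simp [swapIdx, qElem, pattern, hi, hj, hY]
    have e2 (i : Fin n) : (qElem A X h).submatrix (swapIdx r) (swapIdx r)
        (.inl (.inr i)) (.inr 0) = if (i : ℕ) < r then -(A *ᵥ h) i else 0 := by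
      by_cases hi : (i : ℕ) < r <;> simp [swapIdx, qElem, pattern, hi, Matrix.mul_apply, mulVec,
        dotProduct]
    have e3 (j : Fin n) : (qElem A X h).submatrix (swapIdx r) (swapIdx r)
        (.inr 0) (.inl (.inl j)) = if (j : ℕ) < r then h j else 0 := by
      by_cases hj : (j : ℕ) < r <;> simp [swapIdx, qElem, pattern, hj]
    have e4 : (qElem A X h).submatrix (swapIdx r) (swapIdx r) (.inr 0) (.inr 0) = 1 := by
      simp [swapIdx, qElem, pattern]
    simp only [e1, e2, e3, e4]
    constructor
    · rintro ⟨h1, h2, h3, -⟩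
      refine ⟨fun i j hi hj => ?_, fun i j hi hj => ?_, fun i j hi hj => ?_, fun i hi => ?_,
        fun i hi => ?_⟩
      · simpa [hi, hj] using h1 i j
      · simpa [hi, hj] using h1 j i
      · simpa [hi, hj] using h1 i j
      · simpa [hi] using h2 i
      · simpa [hi] using h3 i
    · rintro ⟨h1, h2, h3, h4, h5⟩
      refine ⟨fun i j => ?_, fun i => ?_, fun i => ?_, trivial⟩
      · split_ifs with hi hj hj
        · exact h3 i j hi hj
        · exact h1 i j hi hj
        · exact h2 j i hj hi
        · rfl
      · split_ifs with hi
        · rw [h4 i hi, neg_zero]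
        · rfl
      · split_ifs with hi
        · exact h5 i hi
        · rfl
  rw [key]
  constructor
  · rintro ⟨h1, h2, h3, -, h5⟩
    refine ⟨h1, h5, fun i j hi hj => ?_⟩
    -- Write `Y = A⁻¹(AY)`: for each summation index either the entry of `A⁻¹` or the entry of `AY`
    -- vanishes.
    have h6 : Y i j = 0 := by
      rw [← nonsing_inv_mul_cancel_left A Y hA.isUnit, Matrix.mul_apply]
      refine sum_eq_zero fun k _ => ?_
      by_cases hk : (k : ℕ) < r
      · rw [h3 k j hk hj, mul_zero]
      · rw [h2 i k hi hk, zero_mul]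
    simpa [hY, vecMulVec, h5 i hi] using h6
  · rintro ⟨h1, h5, h6⟩
    refine ⟨h1, hinv h1, fun i j hi hj => ?_, fun i hi => ?_, h5⟩
    · rw [Matrix.mul_apply]
      refine sum_eq_zero fun k _ => ?_
      by_cases hk : (k : ℕ) < r
      · simp [hY, vecMulVec, h5 k hk, h6 k j hk hj]
      · rw [h1 i k hi hk, zero_mul]
    · change ∑ k, A i k * h k = 0
      refine sum_eq_zero fun k _ => ?_
      by_cases hk : (k : ℕ) < r
      · simp [h5 k hk]
      · simp [h1 i k hi hk]

end Coordinates

/-! ### Sums over double cosets reduced to sums over `Q`. -/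

section DoubleCosets

variable {F : Type*} [Field F] [Fintype F] [DecidableEq F] {n : ℕ}

open Classical in
variable (F n) in
/-- The elements of the parabolic subgroup that stay in it under conjugation by `sigma`. -/
noncomputable def stabFin (r : ℕ) : Finset (Matrix (BlockIdx n) (BlockIdx n) F) :=
  (qFin F n).filter fun w => sigma F n r * w * sigma F n r ∈ subgroupQ F n

theorem mem_stabFin {r : ℕ} {w : Matrix (BlockIdx n) (BlockIdx n) F} : w ∈ stabFin F n r ↔
    w ∈ subgroupQ F n ∧ sigma F n r * w * sigma F n r ∈ subgroupQ F n := by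
  simp [stabFin, mem_qFin]

open Classical in
variable (F n) in
/-- The double coset as a finite set. -/
noncomputable def cosetFin (r : ℕ) : Finset (Matrix (BlockIdx n) (BlockIdx n) F) :=
  univ.filter (· ∈ cosetQ F n r)

theorem mem_cosetFin {r : ℕ} {w : Matrix (BlockIdx n) (BlockIdx n) F} : w ∈ cosetFin F n r ↔
    ∃ x ∈ subgroupQ F n, ∃ y ∈ subgroupQ F n, w = x * sigma F n r * y := by
  simp only [cosetFin, mem_filter, mem_univ, true_and]
  exact DoubleCoset.mem_doubleCoset

theorem card_stabFin [CharP F 3] (r : ℕ) :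
    #(stabFin F n r) = #(stabCoords (F := F) fun i : Fin n => (i : ℕ) < r) := by
  symm
  refine card_bij (fun t _ => qElem t.1 t.2.1 t.2.2) ?_ ?_ ?_
  · rintro ⟨A, X, h⟩ ht
    simp only [stabCoords, mem_filter, mem_univ, true_and] at ht
    rw [mem_stabFin, stab_iff_coords r ht.1 X.2]
    exact ⟨mem_subgroupQ_iff_qElem.2 ⟨A, X, h, ht.1, X.2, rfl⟩, ht.2⟩
  · rintro ⟨A, X, h⟩ ht ⟨A', X', h'⟩ _ H
    simp only [stabCoords, mem_filter, mem_univ, true_and] at ht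
    obtain ⟨h1, h2, h3⟩ := (qElem_inj ht.1).1 H
    exact Prod.ext h1 (Prod.ext (Subtype.ext h2) h3)
  · intro w hw
    rw [mem_stabFin] at hw
    obtain ⟨A, X, h, hA, hX, rfl⟩ := mem_subgroupQ_iff_qElem.1 hw.1
    rw [stab_iff_coords r hA hX] at hw
    refine ⟨(A, ⟨X, hX⟩, h), ?_, rfl⟩
    simp only [stabCoords, mem_filter, mem_univ, true_and]
    exact ⟨hA, hw.2⟩

theorem inv_mul_cancel_of_mem {x : Matrix (BlockIdx n) (BlockIdx n) F} (hx : x ∈ subgroupQ F n)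
    (z : Matrix (BlockIdx n) (BlockIdx n) F) : x⁻¹ * (x * z) = z := by
  rw [← Matrix.mul_assoc, inv_mul_of_mem_subgroupQ hx, Matrix.one_mul]

theorem mul_inv_cancel_of_mem {x : Matrix (BlockIdx n) (BlockIdx n) F} (hx : x ∈ subgroupQ F n)
    (z : Matrix (BlockIdx n) (BlockIdx n) F) : x * (x⁻¹ * z) = z := by
  rw [← Matrix.mul_assoc, mul_inv_of_mem_subgroupQ hx, Matrix.one_mul]

theorem sigma_mul_cancel (r : ℕ) (z : Matrix (BlockIdx n) (BlockIdx n) F) :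
    sigma F n r * (sigma F n r * z) = z := by
  rw [← Matrix.mul_assoc, sigma_mul_sigma, Matrix.one_mul]

/-- The fibre of `(x, y) ↦ x σ y` through `(x₀, y₀)` consists of the pairs `(x₀ t, σ t⁻¹ σ y₀)` with
`t ∈ Q ∩ σQσ`. -/
theorem sum_sum_eq_card_stabFin_mul (r : ℕ) (f : Matrix (BlockIdx n) (BlockIdx n) F → ℂ) :
    ∑ x ∈ qFin F n, ∑ y ∈ qFin F n, f (x * sigma F n r * y) =
      #(stabFin F n r) * ∑ w ∈ cosetFin F n r, f w := by
  rw [← sum_product', ← sum_fiberwise_of_maps_to (t := cosetFin F n r)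
    (g := fun p => p.1 * sigma F n r * p.2), mul_sum]
  · refine sum_congr rfl fun w hw => ?_
    rw [sum_congr rfl (g := fun _ => f w) fun p hp => by rw [(mem_filter.1 hp).2], sum_const,
      nsmul_eq_mul]
    congr 2
    obtain ⟨x₀, hx₀, y₀, hy₀, rfl⟩ := mem_cosetFin.1 hw
    symm
    have hs {t : Matrix (BlockIdx n) (BlockIdx n) F} (ht : t ∈ stabFin F n r) :
        (sigma F n r * t * sigma F n r)⁻¹ = sigma F n r * (t⁻¹ * sigma F n r) := by
      have := (mem_stabFin.1 ht).1
      refine inv_eq_right_inv ?_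
      simp only [Matrix.mul_assoc]
      rw [sigma_mul_cancel, mul_inv_cancel_of_mem this, sigma_mul_sigma]
    refine card_nbij' (fun t => (x₀ * t, sigma F n r * (t⁻¹ * sigma F n r) * y₀))
      (fun p => x₀⁻¹ * p.1) ?_ ?_ ?_ ?_
    · intro t ht
      have ht' := mem_stabFin.1 ht
      simp only [coe_filter, mem_product, mem_qFin, Set.mem_ofPred_eq]
      refine ⟨⟨mul_mem_subgroupQ hx₀ ht'.1, mul_mem_subgroupQ ?_ hy₀⟩, ?_⟩
      · rw [← hs ht]
        exact inv_mem_subgroupQ ht'.2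
      · simp only [Matrix.mul_assoc]
        rw [sigma_mul_cancel, mul_inv_cancel_of_mem ht'.1]
    · rintro ⟨x, y⟩ hp
      simp only [coe_filter, mem_product, mem_qFin, Set.mem_ofPred_eq] at hp
      obtain ⟨⟨hx, hy⟩, hxy⟩ := hp
      refine mem_stabFin.2 ⟨mul_mem_subgroupQ (inv_mem_subgroupQ hx₀) hx, ?_⟩
      have : sigma F n r * (x₀⁻¹ * x) * sigma F n r = y₀ * y⁻¹ := by
        have h1 : x * sigma F n r = x₀ * sigma F n r * y₀ * y⁻¹ := by
          rw [← hxy, Matrix.mul_assoc, mul_inv_of_mem_subgroupQ hy, Matrix.mul_one]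
        rw [Matrix.mul_assoc, Matrix.mul_assoc, h1]
        simp only [Matrix.mul_assoc]
        rw [inv_mul_cancel_of_mem hx₀, sigma_mul_cancel]
      rw [this]
      exact mul_mem_subgroupQ hy₀ (inv_mem_subgroupQ hy)
    · intro t _
      exact inv_mul_cancel_of_mem hx₀ t
    · rintro ⟨x, y⟩ hp
      simp only [coe_filter, mem_product, mem_qFin, Set.mem_ofPred_eq] at hp
      obtain ⟨⟨hx, hy⟩, hxy⟩ := hp
      refine Prod.ext (mul_inv_cancel_of_mem hx₀ x) ?_
      change sigma F n r * ((x₀⁻¹ * x)⁻¹ * sigma F n r) * y₀ = y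
      have h2 : (x₀⁻¹ * x)⁻¹ = x⁻¹ * x₀ := by
        refine inv_eq_right_inv ?_
        rw [Matrix.mul_assoc, mul_inv_cancel_of_mem hx, inv_mul_of_mem_subgroupQ hx₀]
      rw [h2]
      simp only [Matrix.mul_assoc] at hxy ⊢
      rw [← hxy, inv_mul_cancel_of_mem hx, sigma_mul_cancel]
  · rintro ⟨x, y⟩ hp
    simp only [mem_product, mem_qFin] at hp
    exact mem_cosetFin.2 ⟨x, hp.1, y, hp.2, rfl⟩

variable (n) in
/-- `diag(1, 1, ε)`; for `ε = -1` this is `rho`. -/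
def tau (ε : F) : Matrix (BlockIdx n) (BlockIdx n) F :=
  fromBlocks 1 0 0 (of fun _ _ => ε)

theorem tau_mul_tau {ε : F} (hε : ε * ε = 1) : tau n ε * tau n ε = 1 := by
  have h : (of fun _ _ => ε : Matrix (Fin 1) (Fin 1) F) * (of fun _ _ => ε) = 1 := by
    ext i j
    simp [Matrix.mul_apply, hε, Matrix.one_apply, Subsingleton.elim i j]
  rw [tau, fromBlocks_multiply, h]
  simp

/-- Conjugation by `τ` multiplies `c` and `h` by `ε`; the defining relations survive because `ε² =
1`. -/
theorem tau_conj_mem {ε : F} (hε : ε * ε = 1) {w : Matrix (BlockIdx n) (BlockIdx n) F}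
    (hw : w ∈ subgroupQ F n) : tau n ε * w * tau n ε ∈ subgroupQ F n := by
  obtain ⟨h1, A, B, D, c, h, rfl⟩ := mem_subgroupQ_iff_gram.1 hw
  obtain ⟨h1, h2, h3⟩ := (pattern_gram ..).1 h1
  have : tau n ε * pattern A B D c h * tau n ε = pattern A B D (ε • c) (ε • h) := by
    ext ((i | i) | i) ((j | j) | j) <;> (try obtain rfl := Subsingleton.elim i (0 : Fin 1)) <;>
      (try obtain rfl := Subsingleton.elim j (0 : Fin 1)) <;>
      simp [tau, pattern, fromBlocks_multiply, Matrix.mul_apply, Matrix.one_apply, mul_comm, hε]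
  rw [this, mem_subgroupQ_iff_gram]
  refine ⟨(pattern_gram ..).2 ⟨h1, ?_, ?_⟩, _, _, _, _, _, rfl⟩
  · rw [transpose_smul, Matrix.smul_mul, Matrix.mul_smul, smul_smul, hε, one_smul, h2]
  · rw [transpose_smul, Matrix.mul_smul, ← smul_add, h3, smul_zero]

theorem sum_qFin_tau_conj {ε : F} (hε : ε * ε = 1)
    (f : Matrix (BlockIdx n) (BlockIdx n) F → ℂ) :
    ∑ w ∈ qFin F n, f w = ∑ w ∈ qFin F n, f (tau n ε * w * tau n ε) := by
  have h (w : Matrix (BlockIdx n) (BlockIdx n) F) :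
      tau n ε * (tau n ε * w * tau n ε) * tau n ε = w := by
    rw [Matrix.mul_assoc, Matrix.mul_assoc, Matrix.mul_assoc, tau_mul_tau hε, Matrix.mul_one,
      ← Matrix.mul_assoc, tau_mul_tau hε, Matrix.one_mul]
  refine sum_nbij' (fun w => tau n ε * w * tau n ε) (fun w => tau n ε * w * tau n ε) ?_ ?_ ?_ ?_ ?_
  · intro w hw
    exact mem_qFin.2 (tau_conj_mem hε (mem_qFin.1 hw))
  · intro w hw
    exact mem_qFin.2 (tau_conj_mem hε (mem_qFin.1 hw))
  · intro w _; exact h w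
  · intro w _; exact h w
  · intro w _; rw [h]

theorem sum_qFin_mul_right {x : Matrix (BlockIdx n) (BlockIdx n) F} (hx : x ∈ subgroupQ F n)
    (f : Matrix (BlockIdx n) (BlockIdx n) F → ℂ) :
    ∑ w ∈ qFin F n, f (w * x) = ∑ w ∈ qFin F n, f w := by
  refine sum_nbij' (fun w => w * x) (fun w => w * x⁻¹) ?_ ?_ ?_ ?_ ?_
  · intro w hw
    exact mem_qFin.2 (mul_mem_subgroupQ (mem_qFin.1 hw) hx)
  · intro w hw
    exact mem_qFin.2 (mul_mem_subgroupQ (mem_qFin.1 hw) (inv_mem_subgroupQ hx))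
  · intro w _
    rw [Matrix.mul_assoc, mul_inv_of_mem_subgroupQ hx, Matrix.mul_one]
  · intro w _
    rw [Matrix.mul_assoc, inv_mul_of_mem_subgroupQ hx, Matrix.mul_one]
  · intro w _; rfl

theorem card_stabFin_mul_sum_cosetFin {ε : F} (hε : ε * ε = 1) (r : ℕ) (φ : F → ℂ) :
    #(stabFin F n r) * ∑ w ∈ cosetFin F n r, φ (trace (tau n ε * w)) =
      #(qFin F n) * ∑ w ∈ qFin F n, φ (trace (w * (tau n ε * sigma F n r))) := by
  -- Replacing `x` by `τ x τ` moves `τ` next to `σ`. By cyclicity the summand then depends on `y x`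
  -- only, and translating `y` makes the sum over `x` trivial.
  rw [← sum_sum_eq_card_stabFin_mul, sum_qFin_tau_conj hε]
  have h1 (x y : Matrix (BlockIdx n) (BlockIdx n) F) :
      trace (tau n ε * (tau n ε * x * tau n ε * sigma F n r * y)) =
        trace (y * x * (tau n ε * sigma F n r)) := by
    rw [Matrix.mul_assoc y, trace_mul_comm y]
    congr 1
    simp only [← Matrix.mul_assoc]
    rw [tau_mul_tau hε, Matrix.one_mul]
  simp_rw [h1]
  rw [sum_congr rfl fun x hx => sum_qFin_mul_right (mem_qFin.1 hx)
    (fun w => φ (trace (w * (tau n ε * sigma F n r))))]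
  rw [sum_const, nsmul_eq_mul]

theorem card_stabFin_mul_card_cosetFin (r : ℕ) :
    (#(stabFin F n r) * #(cosetFin F n r) : ℂ) = (#(qFin F n) : ℂ) ^ 2 := by
  have h := card_stabFin_mul_sum_cosetFin (F := F) (n := n) (ε := 1) (by simp) r fun _ => 1
  simpa [sq] using h

/-- The exchanged indices pick up diagonal entries of the upper right block `A(ᵗh h + X)`, the fixed
ones those of `A` and `ᵗA⁻¹`, and the last index gives `ε`. -/
theorem trace_qElem_mul (ε : F) (r : ℕ) (A X : Matrix (Fin n) (Fin n) F) (h : Fin n → F) :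
    trace (qElem A X h * (tau n ε * sigma F n r)) =
      ε + (trace (diagonal (fun i : Fin n => if (i : ℕ) < r then 1 else 0) * A *
        (vecMulVec h h + X)) +
      trace (diagonal (1 - fun i : Fin n => if (i : ℕ) < r then (1 : F) else 0) * (A + A⁻¹))) := by
  have h1 : tau n ε * sigma F n r = fromBlocks (fromBlocks
      (diagonal fun i : Fin n => if (i : ℕ) < r then 0 else 1)
      (diagonal fun i : Fin n => if (i : ℕ) < r then 1 else 0)
      (diagonal fun i : Fin n => if (i : ℕ) < r then 1 else 0)
      (diagonal fun i : Fin n => if (i : ℕ) < r then 0 else 1)) 0 0 (of fun _ _ => ε) := by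
    rw [tau, sigma, fromBlocks_multiply]
    simp
  rw [h1, qElem, pattern, fromBlocks_multiply, fromBlocks_multiply, Matrix.mul_assoc (diagonal _) A]
  simp only [trace, Fintype.sum_sum_type, diag_apply, fromBlocks_apply₁₁, fromBlocks_apply₂₂,
    Matrix.add_apply, mul_diagonal, diagonal_mul, Pi.sub_apply, Pi.one_apply, transpose_apply,
    Matrix.mul_zero, add_zero, Matrix.zero_mul, zero_add]
  simp only [Matrix.one_mul, of_apply, Fin.sum_univ_one]
  rw [add_comm ε]
  congr 1
  rw [← sum_add_distrib, ← sum_add_distrib]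
  refine sum_congr rfl fun i _ => ?_
  split_ifs <;> ring

theorem sum_qFin_addChar [CharP F 3] (ψ : AddChar F ℂ) (ε : F) (r : ℕ) :
    ∑ w ∈ qFin F n, ψ (trace (w * (tau n ε * sigma F n r))) =
      ψ ε * parabolicSum ψ fun i : Fin n => if (i : ℕ) < r then (1 : F) else 0 := by
  rw [sum_qFin, parabolicSum]
  simp_rw [trace_qElem_mul, AddChar.map_add_eq_mul ψ ε, mul_sum]

theorem two_ne_zero_of_charP_three [CharP F 3] : (2 : F) ≠ 0 := by
  intro h
  have h' : ((2 : ℕ) : F) = 0 := by exact_mod_cast h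
  rw [CharP.cast_eq_zero_iff F 3] at h'
  omega

/-- The first `r` indices followed by the last `k`. -/
def splitEquiv {n r k : ℕ} (h : r + k = n) : Fin n ≃ Fin r ⊕ Fin k :=
  (finCongr h.symm).trans finSumFinEquiv.symm

theorem lt_iff_isLeft_splitEquiv {n r k : ℕ} (h : r + k = n) (i : Fin n) :
    (i : ℕ) < r ↔ (splitEquiv h i).isLeft := by
  obtain ⟨x, rfl⟩ := (splitEquiv h).symm.surjective i
  rw [Equiv.apply_symm_apply]
  rcases x with x | x <;> simp [splitEquiv]

theorem parabolicSum_eq [CharP F 3] {ψ : AddChar F ℂ} (hψ : ψ ≠ 0) {m k : ℕ}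
    (h : 2 * m + k = n) :
    parabolicSum ψ (fun i : Fin n => if (i : ℕ) < 2 * m then (1 : F) else 0) =
      (Fintype.card F : ℂ) ^ n.choose 2 * (Fintype.card F : ℂ) ^ k *
        (Fintype.card F : ℂ) ^ (k * (2 * m)) * symmCount F (2 * m) * klGL (Fin k) ψ := by
  have h2 : (2 : F) ≠ 0 := two_ne_zero_of_charP_three
  have hd : (fun i : Fin n => if (i : ℕ) < 2 * m then (1 : F) else 0) ∘ (splitEquiv h).symm =
      Sum.elim (1 : Fin (2 * m) → F) (0 : Fin k → F) := by
    ext x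
    rcases x with x | x <;> simp [lt_iff_isLeft_splitEquiv h]
  rw [parabolicSum_reindex (splitEquiv h), hd, parabolicSum_blocks h2 hψ m (by simp), card_skew h2]
  simp [h]

theorem card_stabFin_eq [CharP F 3] {r k : ℕ} (h : r + k = n) :
    #(stabFin F n r) = glCount F r * glCount F k * Fintype.card F ^ (k * r) *
      (Fintype.card F ^ (r * k) * Fintype.card F ^ k.choose 2) * Fintype.card F ^ k := by
  have h2 : (2 : F) ≠ 0 := two_ne_zero_of_charP_three
  rw [card_stabFin, card_stabCoords_congr (splitEquiv h) _ (fun x => x.isLeft)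
    (lt_iff_isLeft_splitEquiv h), card_stabCoords_blocks, card_skew_corner_zero, card_skew h2,
    card_invMat, card_invMat]
  simp

end DoubleCosets

/-! ### Matching the group orders with the closed forms of `A` and `B`. -/

section Counting

variable {F : Type*} [Field F] [Fintype F] [DecidableEq F]

theorem choose_two_mul_add (m : ℕ) : (2 * m).choose 2 + m = 2 * (m * m) := by
  induction m with
  | zero => rfl
  | succ m ih =>
    have h1 := Nat.choose_succ_succ' (2 * m + 1) 1
    have h2 := Nat.choose_succ_succ' (2 * m) 1
    simp only [Nat.choose_one_right] at h1 h2
    rw [show 2 * (m + 1) = 2 * m + 1 + 1 by ring, h1, h2]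
    nlinarith

theorem glCount_two_mul (m : ℕ) : (glCount F (2 * m) : ℂ) =
    (Fintype.card F : ℂ) ^ (2 * m).choose 2 *
      (∏ j ∈ Icc 1 m, ((Fintype.card F : ℂ) ^ (2 * j - 1) - 1)) *
      ∏ j ∈ Icc 1 m, ((Fintype.card F : ℂ) ^ (2 * j) - 1) := by
  induction m with
  | zero => simp [glCount_zero]
  | succ m ih =>
    have h1 := Nat.choose_succ_succ' (2 * m + 1) 1
    have h2 := Nat.choose_succ_succ' (2 * m) 1
    simp only [Nat.choose_one_right] at h1 h2
    rw [prod_Icc_succ_top (by omega), prod_Icc_succ_top (by omega),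
      show 2 * (m + 1) = 2 * m + 1 + 1 by ring, h1, h2, glCount_succ, glCount_succ, ih,
      show 2 * m + 1 + 1 - 1 = 2 * m + 1 by omega]
    ring

theorem glCount_ne_zero (n : ℕ) : (glCount F n : ℂ) ≠ 0 := by
  rw [glCount, Nat.cast_ne_zero, card_ne_zero]
  exact ⟨1, by simp [mem_invMat]⟩

theorem card_field_pow_sub_one_ne_zero {k : ℕ} (hk : k ≠ 0) :
    (Fintype.card F : ℂ) ^ k - 1 ≠ 0 := by
  have h : 1 < Fintype.card F ^ k := Nat.one_lt_pow hk Fintype.one_lt_card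
  rw [sub_ne_zero]
  exact_mod_cast h.ne'

theorem card_field_ne_zero : (Fintype.card F : ℂ) ≠ 0 := by
  exact_mod_cast Fintype.card_ne_zero

theorem card_stabFin_ne_zero [CharP F 3] {n r k : ℕ} (h : r + k = n) :
    (#(stabFin F n r) : ℂ) ≠ 0 := by
  rw [card_stabFin_eq h]
  push_cast
  have h1 := glCount_ne_zero (F := F) r
  have h2 := glCount_ne_zero (F := F) k
  have h3 := card_field_ne_zero (F := F)
  positivity

variable (F) in
/-- The contribution to the parabolic sum of everything but the Kloosterman sum. -/
noncomputable def unipotentFactor (n m k : ℕ) : ℂ :=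
  (Fintype.card F : ℂ) ^ n.choose 2 * (Fintype.card F : ℂ) ^ k *
    (Fintype.card F : ℂ) ^ (k * (2 * m)) * symmCount F (2 * m)

/-- Here `hA` and `hB` express `A` and `B` through `|Q|`, the stabilizer and the factor of the
Kloosterman term. Together with `|stab| · |coset| = |Q|²` they give the size of the coset. -/
theorem card_cosetFin_eq [CharP F 3] {n m k : ℕ} (h : 2 * m + k = n) {A B κ : ℂ}
    (hA : #(qFin F n) * (unipotentFactor F n m k * κ) = #(stabFin F n (2 * m)) * A)
    (hB : (#(qFin F n) : ℂ) = B * (unipotentFactor F n m k * κ)) :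
    (#(cosetFin F n (2 * m)) : ℂ) = A * B := by
  refine mul_left_cancel₀ (card_stabFin_ne_zero (F := F) h) ?_
  rw [card_stabFin_mul_card_cosetFin, ← mul_assoc, ← hA, sq]
  -- Only one of the two factors `|Q|` is expanded; the other already occurs on the right.
  nth_rewrite 2 [hB]
  ring

theorem sum_cosetFin_eq [CharP F 3] {n m k : ℕ} (h : 2 * m + k = n) {A κ K : ℂ}
    (hA : #(qFin F n) * (unipotentFactor F n m k * κ) = #(stabFin F n (2 * m)) * A)
    {ψ : AddChar F ℂ} (hψ : ψ ≠ 0) (hK : klGL (Fin k) ψ = κ * K) {ε : F} (hε : ε * ε = 1) :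
    ∑ w ∈ cosetFin F n (2 * m), ψ (trace (tau n ε * w)) = ψ ε * A * K := by
  refine mul_left_cancel₀ (card_stabFin_ne_zero (F := F) h) ?_
  rw [card_stabFin_mul_sum_cosetFin hε, sum_qFin_addChar, parabolicSum_eq hψ h, hK,
    ← unipotentFactor]
  linear_combination ψ ε * K * hA

theorem card_qFin_eq [CharP F 3] (n : ℕ) : (#(qFin F n) : ℂ) = glCount F n *
    ((Fintype.card F : ℂ) ^ n.choose 2 * (Fintype.card F : ℂ) ^ n) := by
  rw [card_qFin, card_skew two_ne_zero_of_charP_three]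
  simp

theorem choose_two_mul_add_one (m : ℕ) : (2 * m + 1).choose 2 = (2 * m).choose 2 + 2 * m := by
  rw [Nat.choose_succ_succ' (2 * m) 1, Nat.choose_one_right, add_comm]

theorem choose_two_mul_add_two (m : ℕ) : (2 * m + 2).choose 2 = (2 * m).choose 2 + (4 * m + 1) := by
  rw [Nat.choose_succ_succ' (2 * m + 1) 1, Nat.choose_one_right, choose_two_mul_add_one]
  ring

theorem AMinus_eq (m q : ℕ) : (AMinus (2 * m + 1) q : ℂ) =
    (q : ℂ) ^ (5 * (m * m) + 5 * m + 1) * (((q : ℂ) ^ (2 * m + 1) - 1) / ((q : ℂ) - 1)) *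
      ∏ j ∈ Icc 1 m, ((q : ℂ) ^ (2 * j - 1) - 1) := by
  have h1 : (5 * (2 * m + 1) ^ 2 - 1) / 4 = 5 * (m * m) + 5 * m + 1 := by
    rw [show 5 * (2 * m + 1) ^ 2 = 4 * (5 * (m * m) + 5 * m + 1) + 1 by ring]
    omega
  have h2 : (2 * m + 1 - 1) / 2 = m := by omega
  rw [AMinus, h1, h2, qBinom]
  simp

theorem BMinus_eq (m q : ℕ) : (BMinus (2 * m + 1) q : ℂ) =
    (q : ℂ) ^ (m * m) * ((q : ℂ) ^ (2 * m + 1) - 1) * ∏ j ∈ Icc 1 m, ((q : ℂ) ^ (2 * j) - 1) := by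
  have h1 : (2 * m + 1 - 1) ^ 2 / 4 = m * m := by
    rw [Nat.add_sub_cancel, show (2 * m) ^ 2 = 4 * (m * m) by ring]
    omega
  have h2 : (2 * m + 1 - 1) / 2 = m := by omega
  rw [BMinus, h1, h2]
  simp

theorem APlus_eq (m q : ℕ) : (APlus (2 * m + 2) q : ℂ) =
    (q : ℂ) ^ (5 * (m * m) + 9 * m + 4) * (((q : ℂ) ^ (2 * m + 2) - 1) / ((q : ℂ) ^ 2 - 1) *
      (((q : ℂ) ^ (2 * m + 1) - 1) / ((q : ℂ) - 1))) *
      ∏ j ∈ Icc 1 m, ((q : ℂ) ^ (2 * j - 1) - 1) := by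
  have h1 : (5 * (2 * m + 2) ^ 2 - 2 * (2 * m + 2)) / 4 = 5 * (m * m) + 9 * m + 4 := by
    rw [show 5 * (2 * m + 2) ^ 2 = 4 * (5 * (m * m) + 9 * m + 4) + 2 * (2 * m + 2) by ring]
    omega
  have h2 : (2 * m + 2 - 2) / 2 = m := by omega
  rw [APlus, h1, h2, qBinom]
  simp only [prod_range_succ, range_zero, prod_empty, one_mul, tsub_zero,
    show 2 * m + 2 - 1 = 2 * m + 1 by omega, show 2 - 1 = 1 by omega, pow_one]
  push_cast
  rfl

theorem BPlus_eq (m q : ℕ) : (BPlus (2 * m + 2) q : ℂ) =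
    (q : ℂ) ^ (m * m) * ((q : ℂ) ^ (2 * m + 2) - 1) * ((q : ℂ) ^ (2 * m + 1) - 1) *
      ∏ j ∈ Icc 1 m, ((q : ℂ) ^ (2 * j) - 1) := by
  have h1 : (2 * m + 2 - 2) ^ 2 / 4 = m * m := by
    rw [Nat.add_sub_cancel, show (2 * m) ^ 2 = 4 * (m * m) by ring]
    omega
  have h2 : (2 * m + 2 - 2) / 2 = m := by omega
  rw [BPlus, h1, h2]
  simp

/-- The value `2m² - m` of the binomial coefficient, stated without subtraction, so that the
exponent can be treated as an opaque `c` in the polynomial identities below. -/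
theorem pow_choose_two_mul (m : ℕ) (q : ℂ) :
    q ^ (2 * m).choose 2 * q ^ m = q ^ (m * m) * q ^ (m * m) := by
  rw [← pow_add, ← pow_add, choose_two_mul_add, two_mul]

theorem glCount_one : (glCount F 1 : ℂ) = Fintype.card F - 1 := by
  have h := glCount_succ (F := F) 0
  rw [glCount_zero] at h
  simpa using h

theorem glCount_two : (glCount F 2 : ℂ) =
    ((Fintype.card F : ℂ) ^ 2 - 1) * Fintype.card F * (Fintype.card F - 1) := by
  rw [glCount_succ 1, glCount_one, pow_one]

theorem card_qFin_minus [CharP F 3] (m : ℕ) : (#(qFin F (2 * m + 1)) : ℂ) =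
    BMinus (2 * m + 1) (Fintype.card F) * (unipotentFactor F (2 * m + 1) m 1 * 1) := by
  rw [card_qFin_eq, BMinus_eq, unipotentFactor, symmCount_even, glCount_succ, glCount_two_mul,
    choose_two_mul_add_one]
  have hc := pow_choose_two_mul m (Fintype.card F : ℂ)
  generalize (2 * m).choose 2 = c at *
  generalize ∏ j ∈ Icc 1 m, ((Fintype.card F : ℂ) ^ (2 * j - 1) - 1) = P₁
  generalize ∏ j ∈ Icc 1 m, ((Fintype.card F : ℂ) ^ (2 * j) - 1) = P₂
  generalize (Fintype.card F : ℂ) = q at *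
  linear_combination (q ^ (2 * m + 1) - 1) * P₁ * P₂ * q ^ (c + 5 * m + 1) * hc

theorem card_qFin_mul_minus [CharP F 3] (m : ℕ) :
    #(qFin F (2 * m + 1)) * (unipotentFactor F (2 * m + 1) m 1 * 1) =
      #(stabFin F (2 * m + 1) (2 * m)) * (AMinus (2 * m + 1) (Fintype.card F) : ℂ) := by
  rw [card_qFin_eq, AMinus_eq, unipotentFactor, symmCount_even, glCount_succ,
    choose_two_mul_add_one, card_stabFin_eq (F := F) (r := 2 * m) (k := 1) rfl]
  have hc := pow_choose_two_mul m (Fintype.card F : ℂ)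
  have h1 := card_field_pow_sub_one_ne_zero (F := F) one_ne_zero
  rw [pow_one] at h1
  push_cast
  rw [glCount_one, Nat.choose_eq_zero_of_lt (by omega : 1 < 2)]
  generalize (2 * m).choose 2 = c at *
  generalize ∏ j ∈ Icc 1 m, ((Fintype.card F : ℂ) ^ (2 * j - 1) - 1) = P₁
  generalize (glCount F (2 * m) : ℂ) = G
  generalize (Fintype.card F : ℂ) = q at *
  have hd := mul_div_cancel₀ (q ^ (2 * m + 1) - 1) h1
  -- `q ^ c` occurs squared, once from `|Q|` and once from `unipotentFactor`, so `hc` is multiplied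
  -- by the sum of its two sides; `hd` clears the denominator of the `q`-binomial coefficient.
  linear_combination (q ^ (2 * m + 1) - 1) * P₁ * G * q ^ (m * m + 9 * m + 2) *
    (q ^ c * q ^ m + q ^ (m * m) * q ^ (m * m)) * hc -
    G * P₁ * q ^ (5 * (m * m) + 9 * m + 2) * hd

theorem card_qFin_plus [CharP F 3] (m : ℕ) : (#(qFin F (2 * m + 2)) : ℂ) =
    BPlus (2 * m + 2) (Fintype.card F) *
      (unipotentFactor F (2 * m + 2) m 2 * Fintype.card F) := by
  rw [card_qFin_eq, BPlus_eq, unipotentFactor, symmCount_even, glCount_succ, glCount_succ,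
    glCount_two_mul, choose_two_mul_add_two]
  have hc := pow_choose_two_mul m (Fintype.card F : ℂ)
  generalize (2 * m).choose 2 = c at *
  generalize ∏ j ∈ Icc 1 m, ((Fintype.card F : ℂ) ^ (2 * j - 1) - 1) = P₁
  generalize ∏ j ∈ Icc 1 m, ((Fintype.card F : ℂ) ^ (2 * j) - 1) = P₂
  generalize (Fintype.card F : ℂ) = q at *
  linear_combination (q ^ (2 * m + 2) - 1) * (q ^ (2 * m + 1) - 1) * P₁ * P₂ *
    q ^ (c + 9 * m + 4) * hc

theorem card_qFin_mul_plus [CharP F 3] (m : ℕ) :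
    #(qFin F (2 * m + 2)) * (unipotentFactor F (2 * m + 2) m 2 * Fintype.card F) =
      #(stabFin F (2 * m + 2) (2 * m)) * (APlus (2 * m + 2) (Fintype.card F) : ℂ) := by
  rw [card_qFin_eq, APlus_eq, unipotentFactor, symmCount_even, glCount_succ, glCount_succ,
    choose_two_mul_add_two, card_stabFin_eq (F := F) (r := 2 * m) (k := 2) rfl]
  have hc := pow_choose_two_mul m (Fintype.card F : ℂ)
  have h1 := card_field_pow_sub_one_ne_zero (F := F) one_ne_zero
  have h2 := card_field_pow_sub_one_ne_zero (F := F) two_ne_zero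
  rw [pow_one] at h1
  push_cast
  rw [glCount_two, Nat.choose_self]
  generalize (2 * m).choose 2 = c at *
  generalize ∏ j ∈ Icc 1 m, ((Fintype.card F : ℂ) ^ (2 * j - 1) - 1) = P₁
  generalize (glCount F (2 * m) : ℂ) = G
  generalize (Fintype.card F : ℂ) = q at *
  have hd : (q ^ 2 - 1) * (q - 1) * ((q ^ (2 * m + 2) - 1) / (q ^ 2 - 1) *
      ((q ^ (2 * m + 1) - 1) / (q - 1))) = (q ^ (2 * m + 2) - 1) * (q ^ (2 * m + 1) - 1) := by
    field_simp
  generalize (q ^ (2 * m + 2) - 1) / (q ^ 2 - 1) * ((q ^ (2 * m + 1) - 1) / (q - 1)) = R at *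
  linear_combination (q ^ (2 * m + 2) - 1) * (q ^ (2 * m + 1) - 1) * P₁ * G *
    q ^ (m * m + 17 * m + 8) * (q ^ c * q ^ m + q ^ (m * m) * q ^ (m * m)) * hc -
    G * P₁ * q ^ (5 * (m * m) + 17 * m + 8) * hd

end Counting

/-! ### The codewords: membership in the dual code and Hamming weight. -/

section Words

variable {F : Type*} [Field F] [Fintype F] [DecidableEq F] [Algebra (ZMod 3) F]

/-- By `𝔽₃`-linearity of the trace, `c(a) · u = tr(a (u · v))`. -/
theorem codeword_mem_dualCode {n N : ℕ} {D : Set (Matrix (BlockIdx n) (BlockIdx n) F)}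
    (g : Fin N ≃ D) (a : F) : codeword g a ∈ dualCode (ternaryCode (traceVector g)) := by
  intro u hu
  have hu' : ∑ j, algebraMap (ZMod 3) F (u j) * traceVector g j = 0 := hu
  have h : codeword g a ⬝ᵥ u =
      Algebra.trace (ZMod 3) F (a * ∑ j, algebraMap (ZMod 3) F (u j) * traceVector g j) := by
    rw [mul_sum, map_sum]
    refine sum_congr rfl fun j _ => ?_
    rw [codeword, mul_left_comm, ← Algebra.smul_def, map_smul, smul_eq_mul, mul_comm]
  rw [h, hu', mul_zero, map_zero]

theorem stdAddChar_three_indicator (z : ZMod 3) :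
    (if z ≠ 0 then (1 : ℂ) else 0) =
      (2 - ZMod.stdAddChar (N := 3) z - ZMod.stdAddChar (N := 3) (-z)) / 3 := by
  have h0 : ∑ x : ZMod 3, ZMod.stdAddChar (N := 3) x = 0 := by
    rw [AddChar.sum_eq_zero_iff_ne_zero]
    have h := ZMod.isPrimitive_stdAddChar 3 (one_ne_zero (α := ZMod 3))
    rwa [AddChar.mulShift_one] at h
  have h1 : ∑ x : ZMod 3, ZMod.stdAddChar (N := 3) x = ZMod.stdAddChar (N := 3) 0 +
      ZMod.stdAddChar (N := 3) 1 + ZMod.stdAddChar (N := 3) 2 := Fin.sum_univ_three _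
  rw [h1, AddChar.map_zero_eq_one] at h0
  have hz : z = 0 ∨ z = 1 ∨ z = 2 := by decide +revert
  rcases hz with rfl | rfl | rfl
  · norm_num
  · rw [show -(1 : ZMod 3) = 2 from rfl, if_pos (by decide)]
    linear_combination h0 / 3
  · rw [show -(2 : ZMod 3) = 1 from rfl, if_pos (by decide)]
    linear_combination h0 / 3

theorem canonicalChar_apply (x : F) :
    canonicalChar F x = ZMod.stdAddChar (N := 3) (Algebra.trace (ZMod 3) F x) := rfl

/-- The trace to `𝔽₃` is surjective, so some argument has trace `1`. -/
theorem canonicalChar_mulShift_ne_zero {a : F} (ha : a ≠ 0) :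
    (canonicalChar F).mulShift a ≠ 0 := by
  have : FiniteDimensional (ZMod 3) F := Module.Finite.of_finite
  obtain ⟨x, hx⟩ := Algebra.trace_surjective (ZMod 3) F 1
  rw [AddChar.ne_zero_iff]
  refine ⟨a⁻¹ * x, ?_⟩
  rw [AddChar.mulShift_apply, mul_inv_cancel_left₀ ha, canonicalChar_apply, hx]
  have h := AddChar.map_zero_eq_one (ZMod.stdAddChar (N := 3))
  rw [← h]
  exact fun h' => one_ne_zero (ZMod.injective_stdAddChar h')

theorem canonicalChar_add_neg (a : F) :
    canonicalChar F a + canonicalChar F (-a) = 2 * ((canonicalChar F a).re : ℂ) := by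
  rw [AddChar.map_neg_eq_conj, Complex.add_conj]
  push_cast
  ring

theorem hammingNorm_codeword {n N : ℕ} {D : Set (Matrix (BlockIdx n) (BlockIdx n) F)}
    (g : Fin N ≃ D) (a : F) {r : ℕ} {ε : F} (hε : ε * ε = 1)
    (hD : D = (fun w => tau n ε * w) '' cosetQ F n r) :
    (hammingNorm (codeword g a) : ℂ) = (2 * #(cosetFin F n r) -
      ∑ w ∈ cosetFin F n r, (canonicalChar F).mulShift a (trace (tau n ε * w)) -
      ∑ w ∈ cosetFin F n r, (canonicalChar F).mulShift (-a) (trace (tau n ε * w))) / 3 := by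
  have hinj (w : Matrix (BlockIdx n) (BlockIdx n) F) : tau n ε * (tau n ε * w) = w := by
    rw [← Matrix.mul_assoc, tau_mul_tau hε, Matrix.one_mul]
  have htransfer (φ : Matrix (BlockIdx n) (BlockIdx n) F → ℂ) :
      ∑ j, φ (g j) = ∑ w ∈ cosetFin F n r, φ (tau n ε * w) := by
    refine sum_bij' (fun j _ => tau n ε * (g j : Matrix (BlockIdx n) (BlockIdx n) F))
      (fun w hw => g.symm ⟨tau n ε * w, by
        rw [hD]; exact ⟨w, mem_cosetFin.1 hw |> fun h => DoubleCoset.mem_doubleCoset.2 h, rfl⟩⟩)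
      ?_ ?_ ?_ ?_ ?_
    · intro j _
      obtain ⟨w, hw, h⟩ : (g j : Matrix (BlockIdx n) (BlockIdx n) F) ∈
        (fun w => tau n ε * w) '' cosetQ F n r := hD ▸ (g j).2
      rw [← h]
      dsimp only
      rw [hinj]
      exact mem_cosetFin.2 (DoubleCoset.mem_doubleCoset.1 hw)
    · intro w _; exact mem_univ _
    · intro j _
      simp [hinj]
    · intro w _
      simp [hinj]
    · intro j _
      rw [hinj]
  have h1 : (hammingNorm (codeword g a) : ℂ) = ∑ j, if codeword g a j ≠ 0 then (1 : ℂ) else 0 := by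
    rw [hammingNorm, sum_boole]
  have h2 : (#(cosetFin F n r) : ℂ) = ∑ _j : Fin N, 1 := by
    rw [htransfer fun _ => 1]; simp
  have h3 (j : Fin N) : ZMod.stdAddChar (N := 3) (-codeword g a j) =
      (canonicalChar F).mulShift (-a) (trace (g j : Matrix (BlockIdx n) (BlockIdx n) F)) := by
    rw [AddChar.mulShift_apply, canonicalChar_apply, neg_mul,
      map_neg (Algebra.trace (ZMod 3) F)]
    rfl
  have h4 (j : Fin N) : ZMod.stdAddChar (N := 3) (codeword g a j) =
      (canonicalChar F).mulShift a (trace (g j : Matrix (BlockIdx n) (BlockIdx n) F)) := rfl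
  rw [h1, h2, ← htransfer fun w => (canonicalChar F).mulShift a (trace w),
    ← htransfer fun w => (canonicalChar F).mulShift (-a) (trace w), mul_sum, ← sum_sub_distrib,
    ← sum_sub_distrib, sum_div]
  refine sum_congr rfl fun j _ => ?_
  rw [stdAddChar_three_indicator, h3, h4, mul_one]

/-- Everything common to the four families; `κ` separates a constant from the Kloosterman expression
`K`. In `hK` the character is shifted by `b = ±a`, because the weight involves both signs. -/
theorem hammingNorm_codeword_eq {n N m k : ℕ} (h : 2 * m + k = n)
    {D : Set (Matrix (BlockIdx n) (BlockIdx n) F)} (g : Fin N ≃ D) {a : F} (ha : a ≠ 0)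
    (hD : D = cosetQ F n (2 * m) ∨ D = cosetRhoQ F n (2 * m)) {A B κ K : ℂ}
    (hA : #(qFin F n) * (unipotentFactor F n m k * κ) = #(stabFin F n (2 * m)) * A)
    (hB : (#(qFin F n) : ℂ) = B * (unipotentFactor F n m k * κ))
    (hK : ∀ b : F, b ≠ 0 → b ^ 2 = a ^ 2 → klGL (Fin k) ((canonicalChar F).mulShift b) = κ * K) :
    (hammingNorm (codeword g a) : ℂ) =
      2 / 3 * A * (B - ((canonicalChar F a).re : ℂ) * K) := by
  have : CharP F 3 := charP_of_injective_algebraMap (algebraMap (ZMod 3) F).injective 3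
  obtain ⟨ε, hε, hD'⟩ : ∃ ε : F, (ε = 1 ∨ ε = -1) ∧
      D = (fun w => tau n ε * w) '' cosetQ F n (2 * m) := by
    rcases hD with rfl | rfl
    · refine ⟨1, Or.inl rfl, ?_⟩
      have : tau n (1 : F) = 1 := by
        have h1 : (of fun _ _ => 1 : Matrix (Fin 1) (Fin 1) F) = 1 := by
          ext i j
          rw [Subsingleton.elim i j, one_apply_eq]
          rfl
        rw [tau, h1, fromBlocks_one]
      simp [this]
    · refine ⟨-1, Or.inr rfl, ?_⟩
      have : tau n (-1 : F) = rho F n := by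
        rw [tau, rho]
        congr 1
        ext i j
        simp [Subsingleton.elim i j]
      rw [this]
      rfl
  have hε2 : ε * ε = 1 := by rcases hε with rfl | rfl <;> ring
  have hna : -a ≠ 0 := neg_ne_zero.2 ha
  -- Changing the sign of `ε` merely exchanges the two terms, which is why both cosets have the same
  -- weight.
  have hsum : (canonicalChar F).mulShift a ε + (canonicalChar F).mulShift (-a) ε =
      2 * ((canonicalChar F a).re : ℂ) := by
    rw [← canonicalChar_add_neg, AddChar.mulShift_apply, AddChar.mulShift_apply]
    rcases hε with rfl | rfl
    · simp
    · simp [add_comm]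
  rw [hammingNorm_codeword g a hε2 hD', card_cosetFin_eq h hA hB,
    sum_cosetFin_eq h hA (canonicalChar_mulShift_ne_zero ha) (hK a ha rfl) hε2,
    sum_cosetFin_eq h hA (canonicalChar_mulShift_ne_zero hna) (hK (-a) hna (neg_sq a)) hε2]
  linear_combination (-A * K / 3) * hsum

end Words

end TernaryKloosterman

/-! ### The theorem: `k = 1` for odd `n`, `k = 2` for even `n`. -/

open TernaryKloosterman

theorem lemma5p2 {F : Type*} [Field F] [Fintype F] [DecidableEq F] [Algebra (ZMod 3) F]
    (a : F) (ha : a ≠ 0) :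
    (∀ n : ℕ, Odd n →
      ∀ D : Set (Matrix (TernaryKloosterman.BlockIdx n) (TernaryKloosterman.BlockIdx n) F),
        (D = TernaryKloosterman.DCMinus₁ F n ∨ D = TernaryKloosterman.DCMinus₂ F n) →
      ∀ (N : ℕ) (g : Fin N ≃ D),
        TernaryKloosterman.codeword g a ∈
          TernaryKloosterman.dualCode
            (TernaryKloosterman.ternaryCode (TernaryKloosterman.traceVector g)) ∧
        (hammingNorm (TernaryKloosterman.codeword g a) : ℂ) =
          2 / 3 * (TernaryKloosterman.AMinus n (Fintype.card F) : ℂ) *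
            ((TernaryKloosterman.BMinus n (Fintype.card F) : ℂ) -
              ((TernaryKloosterman.canonicalChar F a).re : ℂ) *
                TernaryKloosterman.kloosterman (TernaryKloosterman.canonicalChar F) (a ^ 2))) ∧
    (∀ n : ℕ, Even n → 2 ≤ n →
      ∀ D : Set (Matrix (TernaryKloosterman.BlockIdx n) (TernaryKloosterman.BlockIdx n) F),
        (D = TernaryKloosterman.DCPlus₁ F n ∨ D = TernaryKloosterman.DCPlus₂ F n) →
      ∀ (N : ℕ) (g : Fin N ≃ D),
        TernaryKloosterman.codeword g a ∈
          TernaryKloosterman.dualCode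
            (TernaryKloosterman.ternaryCode (TernaryKloosterman.traceVector g)) ∧
        (hammingNorm (TernaryKloosterman.codeword g a) : ℂ) =
          2 / 3 * (TernaryKloosterman.APlus n (Fintype.card F) : ℂ) *
            ((TernaryKloosterman.BPlus n (Fintype.card F) : ℂ) -
              ((TernaryKloosterman.canonicalChar F a).re : ℂ) *
                (TernaryKloosterman.kloosterman (TernaryKloosterman.canonicalChar F) (a ^ 2) ^ 2 +
                  (Fintype.card F : ℂ) ^ 2 - (Fintype.card F : ℂ)))) := by
  have : CharP F 3 := charP_of_injective_algebraMap (algebraMap (ZMod 3) F).injective 3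
  constructor
  · rintro n ⟨m, rfl⟩ D hD N g
    -- The index `2m + 1 - 1` in the coset reduces to `2m` by definition, so `hD` fits as it stands.
    refine ⟨codeword_mem_dualCode g a, hammingNorm_codeword_eq (m := m) (k := 1) rfl g ha hD
      (card_qFin_mul_minus m) (card_qFin_minus m) fun b hb hba => ?_⟩
    rw [klGL_of_card_eq_one (by simp), kloosterman_mulShift _ hb, hba, one_mul]
  · rintro n hn h2 D hD N g
    obtain ⟨m, rfl⟩ : ∃ m, n = 2 * m + 2 := by
      obtain ⟨k, rfl⟩ := hn
      exact ⟨k - 1, by omega⟩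
    refine ⟨codeword_mem_dualCode g a, hammingNorm_codeword_eq (m := m) (k := 2) rfl g ha hD
      (card_qFin_mul_plus m) (card_qFin_plus m) fun b hb hba => ?_⟩
    rw [klGL_of_card_eq_two (by simp) _ (canonicalChar_mulShift_ne_zero hb),
      kloosterman_mulShift _ hb, hba]
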